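/- Let $k\ge 1$, $n, T\ge 0$ be integers and $V=[n]$. On $\{0,1,\dots,k\}$ put $i\sqcup i'=\max\{i,i'\}$ and $i\sqcap i'=\min\{i,i'\}$ if $i=0$, $i'=0$ or $i=i'$, and $i\sqcup i'=i\sqcap i'=0$ otherwise; extend both operations entrywise to $(k+1)^V=\{0,1,\dots,k\}^V$. A function $f:(k+1)^V\to\mathbb{R}$ is $k$-submodular if $f(\mathbf{x})+f(\mathbf{y})\ge f(\mathbf{x}\sqcup\mathbf{y})+f(\mathbf{x}\sqcap\mathbf{y})$ for all $\mathbf{x},\mathbf{y}$, and monotone if $f(\mathbf{x})\le f(\mathbf{y})$ whenever $\mathbf{x}\sqcap\mathbf{y}=\mathbf{x}$. In online monotone $k$-submodular maximization, in each round $t=1,\dots,T$ a randomized player plays $\mathbf{x}_t\in(k+1)^V$, and then a monotone $k$-submodular function $f_t:(k+1)^V\to[0,1]$, selected by an adversary, is revealed to the player as a value oracle; the player gains $f_t(\mathbf{x}_t)$. The adversary may be adaptive: $f_t$ may depend on $\mathbf{x}_1,\dots,\mathbf{x}_{t-1}$ (but not on the outcome $\mathbf{x}_t$). **Theorem.** There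 are a single randomized algorithm (a fixed program for a randomized real random-access machine with unit-cost real arithmetic, uniform random reals of $[0,1]$ and a value oracle, which receives $n,k,T$ as input), a polynomial $P$ and an absolute constant $C$ such that for all $n,T\ge 0$, $k\ge1$ and every such adversary the algorithm makes at most $P(n,k,T)$ steps in total in the $T$ rounds, for every outcome of its random draws, and its expected $\frac{k}{2k-1}$-regret satisfies $$\mathbf{E}\left[\frac{k}{2k-1}\max_{\mathbf{o}\in(k+1)^V}\sum_{t=1}^T f_t(\mathbf{o})-\sum_{t=1}^T f_t(\mathbf{x}_t)\right]\le C\,k\,n\,\sqrt{T},$$ where the expectation is over the player's randomness. -/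

import Mathlib

open MeasureTheory

noncomputable section

namespace KSub

/-! ### `k`-submodular functions -/

/-- The set `(k+1)^V = {0, 1, …, k}^V` for `V = [n]`. -/
abbrev Action (n k : ℕ) : Type := Fin n → Fin (k + 1)

/-- The operation `⊔` on `{0, …, k}`. -/
def joinVal {k : ℕ} (i i' : Fin (k + 1)) : Fin (k + 1) :=
  if i = 0 ∨ i' = 0 ∨ i = i' then max i i' else 0

/-- The operation `⊓` on `{0, …, k}`. -/
def meetVal {k : ℕ} (i i' : Fin (k + 1)) : Fin (k + 1) :=
  if i = 0 ∨ i' = 0 ∨ i = i' then min i i' else 0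

def join {n k : ℕ} (x y : Action n k) : Action n k := fun j => joinVal (x j) (y j)

def meet {n k : ℕ} (x y : Action n k) : Action n k := fun j => meetVal (x j) (y j)

def IsKSubmodular {n k : ℕ} (f : Action n k → ℝ) : Prop :=
  ∀ x y : Action n k, f (join x y) + f (meet x y) ≤ f x + f y

/-- Monotonicity for the partial order `x ≤ y ↔ x ⊓ y = x` (not the pointwise order of `Fin`). -/
def IsMonotone {n k : ℕ} (f : Action n k → ℝ) : Prop :=
  ∀ x y : Action n k, meet x y = x → f x ≤ f y

/-- The reward functions of the online monotone problem: monotone `k`-submodular functions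
`(k+1)^V → [0,1]`. -/
structure IsReward {n k : ℕ} (f : Action n k → ℝ) : Prop where
  submodular : IsKSubmodular f
  monotone : IsMonotone f
  mem_Icc : ∀ x, f x ∈ Set.Icc (0 : ℝ) 1

/-! ### Machine model

A randomized real random-access machine with a value oracle. It has a memory of natural numbers
and a memory of real numbers, both initially zero except for the input and both addressed by pairs
(row, column) of natural numbers that may be computed at run time. Unit-cost operations: addition
and truncated subtraction of natural numbers (no multiplication, so that short computations cannot
produce numbers with exponentially many digits), field operations on reals (no rounding), the cast
of a natural number to a real, comparisons, drawing a uniform random real of `[0,1]`, and calling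
the value oracle. Loops are executed a number of times that is fixed on entry, so every program
halts; a machine with unbounded loops can run all of these programs. -/

inductive NatExpr : Type
  | const (c : ℕ)
  | read (row col : NatExpr)
  | add (e e' : NatExpr)
  | sub (e e' : NatExpr)

inductive RealExpr : Type
  | ofNat (e : NatExpr)
  | read (row col : NatExpr)
  | add (e e' : RealExpr)
  | sub (e e' : RealExpr)
  | mul (e e' : RealExpr)
  | div (e e' : RealExpr)

inductive Cmd : Type
  | skip
  /-- store the value of `e` in the cell `(row, col)` of the natural-number memory -/
  | setNat (row col e : NatExpr)
  /-- store the value of `e` in the cell `(row, col)` of the real memory -/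
  | setReal (row col : NatExpr) (e : RealExpr)
  /-- store a fresh uniform random number in the cell `(row, col)` of the real memory -/
  | draw (row col : NatExpr)
  /-- store in the cell `(row, col)` of the real memory the oracle's value at the vector that is
  held in row `v` of the natural-number memory -/
  | query (row col v : NatExpr)
  | seq (c d : Cmd)
  /-- if `e ≤ e'` then `c` else `d` -/
  | ifNat (e e' : NatExpr) (c d : Cmd)
  /-- if `e ≤ e'` then `c` else `d` -/
  | ifReal (e e' : RealExpr) (c d : Cmd)
  /-- run `c` as many times as the value of `e` on entry -/
  | loop (e : NatExpr) (c : Cmd)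

structure State : Type where
  nat : ℕ → ℕ → ℕ
  real : ℕ → ℕ → ℝ
  /-- the number of random reals drawn so far -/
  draws : ℕ
  /-- the number of elementary steps made so far -/
  time : ℕ

namespace State

def tick (s : State) (m : ℕ) : State := { s with time := s.time + m }

def writeNat (s : State) (r c v : ℕ) : State :=
  { s with nat := Function.update s.nat r (Function.update (s.nat r) c v) }

def writeReal (s : State) (r c : ℕ) (v : ℝ) : State :=
  { s with real := Function.update s.real r (Function.update (s.real r) c v) }

end State

namespace NatExpr

def val (s : State) : NatExpr → ℕ
  | const c => c
  | read r c => s.nat (val s r) (val s c)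
  | add e e' => val s e + val s e'
  | sub e e' => val s e - val s e'

/-- The number of steps for evaluating an expression. -/
def cost : NatExpr → ℕ
  | const _ => 1
  | read r c => cost r + cost c + 1
  | add e e' => cost e + cost e' + 1
  | sub e e' => cost e + cost e' + 1

end NatExpr

namespace RealExpr

/-- Division by zero returns zero. -/
def val (s : State) : RealExpr → ℝ
  | ofNat e => (e.val s : ℝ)
  | read r c => s.real (r.val s) (c.val s)
  | add e e' => val s e + val s e'
  | sub e e' => val s e - val s e'
  | mul e e' => val s e * val s e'
  | div e e' => val s e / val s e'

/-- The number of steps for evaluating an expression. -/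
def cost : RealExpr → ℕ
  | ofNat e => e.cost + 1
  | read r c => r.cost + c.cost + 1
  | add e e' => cost e + cost e' + 1
  | sub e e' => cost e + cost e' + 1
  | mul e e' => cost e + cost e' + 1
  | div e e' => cost e + cost e' + 1

end RealExpr

/-- The random tape: the `m`-th entry is the result of the `m`-th draw. -/
abbrev Tape : Type := ℕ → unitInterval

/-- The law of the random tape: independent entries, uniformly distributed in `[0,1]`. -/
def tapeMeasure : Measure Tape :=
  Measure.infinitePi (fun _ : ℕ => (volume : Measure unitInterval))

open Classical in
/-- Execution of a program with value oracle `orc` and random tape `ω`, counting steps. -/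
def Cmd.exec (orc : (ℕ → ℕ) → ℝ) (ω : Tape) : Cmd → State → State
  | .skip, s => s.tick 1
  | .setNat r c e, s =>
      (s.writeNat (r.val s) (c.val s) (e.val s)).tick (r.cost + c.cost + e.cost + 1)
  | .setReal r c e, s =>
      (s.writeReal (r.val s) (c.val s) (e.val s)).tick (r.cost + c.cost + e.cost + 1)
  | .draw r c, s =>
      { (s.writeReal (r.val s) (c.val s) (ω s.draws : ℝ)).tick (r.cost + c.cost + 1) with
        draws := s.draws + 1 }
  | .query r c v, s =>
      (s.writeReal (r.val s) (c.val s) (orc (s.nat (v.val s)))).tick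
        (r.cost + c.cost + v.cost + 1)
  | .seq c d, s => Cmd.exec orc ω d (Cmd.exec orc ω c s)
  | .ifNat e e' c d, s =>
      if e.val s ≤ e'.val s then Cmd.exec orc ω c (s.tick (e.cost + e'.cost + 1))
      else Cmd.exec orc ω d (s.tick (e.cost + e'.cost + 1))
  | .ifReal e e' c d, s =>
      if e.val s ≤ e'.val s then Cmd.exec orc ω c (s.tick (e.cost + e'.cost + 1))
      else Cmd.exec orc ω d (s.tick (e.cost + e'.cost + 1))
  | .loop e c, s =>
      (fun s' => Cmd.exec orc ω c (s'.tick 1))^[e.val s] (s.tick (e.cost + 1))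

/-! ### The online protocol -/

/-- An online algorithm: two fixed programs that share their memory. In each round `play` chooses
the action, and `learn` then has access to the value oracle of the round's reward function. -/
structure OnlineAlgorithm : Type where
  play : Cmd
  learn : Cmd

/-- Reading a row of the natural-number memory as an element of `(k+1)^V`
(entries that exceed `k` are reduced modulo `k + 1`). -/
def decode (n k : ℕ) (v : ℕ → ℕ) : Action n k := fun j => Fin.ofNat (k + 1) (v j)

/-- The initial state: the input is `n`, `k`, `T`. -/
def initState (n k T : ℕ) : State where
  nat := fun r c =>
    if r = 0 ∧ c = 0 then n else if r = 0 ∧ c = 1 then k else if r = 0 ∧ c = 2 then T else 0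
  real := fun _ _ => 0
  draws := 0
  time := 0

/-- An adaptive adversary: given the player's actions of the preceding rounds (the most recent one
first), it selects the reward function of the current round. An oblivious adversary is one that
uses only the length of this list. -/
abbrev Adversary (n k : ℕ) : Type := List (Action n k) → Action n k → ℝ

section Protocol

variable (A : OnlineAlgorithm) {n k : ℕ} (T : ℕ) (F : Adversary n k) (ω : Tape)

/-- One round, from the state of the machine and the list of the preceding actions: the player
computes its action (with a trivial oracle) and leaves it in row `1` of the natural-number memory;
then it receives the round's reward function as a value oracle. -/
def round (q : State × List (Action n k)) : State × List (Action n k) :=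
  let s := A.play.exec (fun _ => 0) ω q.1
  (A.learn.exec (fun v => F q.2 (decode n k v)) ω s, decode n k (s.nat 1) :: q.2)

/-- The state of the machine and the list of the actions played after `t` rounds. -/
def afterRounds (t : ℕ) : State × List (Action n k) :=
  (round A F ω)^[t] (initState n k T, [])

/-- The action `x_t` (rounds are numbered from `0`). -/
def action (t : ℕ) : Action n k :=
  decode n k ((A.play.exec (fun _ => 0) ω (afterRounds A T F ω t).1).nat 1)

/-- The reward function `f_t` (rounds are numbered from `0`). -/
def reward (t : ℕ) : Action n k → ℝ := F (afterRounds A T F ω t).2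

/-- The number of steps that the algorithm makes during the `T` rounds. -/
def runningTime : ℕ := (afterRounds A T F ω T).1.time

/-- The `α`-regret `α · max_o ∑_t f_t(o) - ∑_t f_t(x_t)` of a run. -/
def regret (α : ℝ) : ℝ :=
  α * Finset.univ.sup' Finset.univ_nonempty
      (fun o : Action n k => ∑ t ∈ Finset.range T, reward A T F ω t o)
    - ∑ t ∈ Finset.range T, reward A T F ω t (action A T F ω t)

end Protocol

end KSub

end

/-! Offline comparison. Turn `o` into the played vector `x` one coordinate at a time. Replacing `o
j` by `x j` loses at most the marginal gain of `o j` on top of the coordinates of `x` below `j`, and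
nothing if `o j` is `0` or `x j`. The marginals of the played colours add up to `f x - f 0 ≤ f x`.
With `c = slack k = 1 - 1/k`, this bounds `f o - (1 + c) * f x` by a sum over coordinates
(`IsReward.sub_le_sum_increment`). As `1 + c = (2k - 1)/k`, this is the required regret up to a
factor.

Each coordinate thus becomes a separate game with payoffs in `ℝ^k`, played by Blackwell
approachability of the negative orthant. Let `w` be the positive part of the regret vector, `W` its
sum and `y ≥ 0` the marginals. If colour `i` has probability `p i`, the expected drift is `∑ w i * y
i - ∑ p i * (w i + c * W) * y i`. The choice `p i = w i / (w i + c * W)` makes it vanish for every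
`y`. Concavity of `v / (v + c)` gives `∑ p i ≤ 1` (`cumProb_le_one`), and unassigned mass only helps
because `y ≥ 0`.

So the expected squared distance from the orthant grows by at most `k` per round
(`integral_potential_le`), and the expected distance is at most `k * √T` per coordinate. Adaptivity
is harmless: the history and the colours already chosen in the round are independent of the next
draw (`integral_drift_nonpos`). Finally, `afterRounds_spec` identifies the machine's run with this
strategy, and `runningTime_le` bounds its time through loops of length at most `n + k`. -/

open MeasureTheory

noncomputable section

namespace KSub

/-! ### Comparison of the played vector with a fixed vector, coordinate by coordinate -/

section Offline

variable {n k : ℕ}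

/-- The vector that agrees with `x` on the coordinates below `j` and with `o` on the others. -/
def splice (x o : Action n k) (j : ℕ) : Action n k := fun l => if (l : ℕ) < j then x l else o l

/-- The gain from colouring coordinate `j` by `i` on top of the first `j` coordinates of `x`. -/
def marg (f : Action n k → ℝ) (x : Action n k) (j : Fin n) (i : Fin (k + 1)) : ℝ :=
  f (Function.update (splice x 0 j) j i) - f (splice x 0 j)

lemma splice_zero (x o : Action n k) : splice x o 0 = o := by
  funext l; simp [splice]

lemma splice_full (x o : Action n k) : splice x o n = x := by
  funext l; simp [splice]

lemma update_splice (x o : Action n k) (j : Fin n) :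
    Function.update (splice x o j) j (x j) = splice x o (j + 1) := by
  funext l
  by_cases h : l = j
  · subst h; simp [splice]
  · have h' : (l : ℕ) ≠ j := fun e => h (Fin.ext e)
    simp only [Function.update_of_ne h, splice]
    congr 1
    exact propext ⟨fun a => by omega, fun a => by omega⟩

lemma update_splice_right (x o : Action n k) (j : Fin n) :
    Function.update (splice x o j) j (o j) = splice x o j :=
  Function.update_eq_self_iff.2 (by simp [splice])

lemma splice_splice (x o o' : Action n k) (j : ℕ) :
    splice (splice x o' j) o j = splice x o j := by
  funext l; simp only [splice]; split_ifs <;> rfl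

lemma joinVal_self (a : Fin (k + 1)) : joinVal a a = a := by simp [joinVal]
lemma meetVal_self (a : Fin (k + 1)) : meetVal a a = a := by simp [meetVal]
lemma joinVal_zero (a : Fin (k + 1)) : joinVal a 0 = a := by simp [joinVal]
lemma zero_joinVal (a : Fin (k + 1)) : joinVal 0 a = a := by simp [joinVal]
lemma meetVal_zero (a : Fin (k + 1)) : meetVal a 0 = 0 := by simp [meetVal]
lemma zero_meetVal (a : Fin (k + 1)) : meetVal 0 a = 0 := by simp [meetVal]

lemma IsMonotone.le_update {f : Action n k → ℝ} (hf : IsMonotone f) {z : Action n k} {j : Fin n}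
    (i : Fin (k + 1)) (hz : z j = 0) : f z ≤ f (Function.update z j i) := by
  refine hf _ _ (funext fun l => ?_)
  by_cases h : l = j
  · subst h; simp [meet, hz, zero_meetVal]
  · simp [meet, Function.update_of_ne h, meetVal_self]

lemma IsReward.marg_nonneg {f : Action n k → ℝ} (hf : IsReward f) (x : Action n k) (j : Fin n)
    (i : Fin (k + 1)) : 0 ≤ marg f x j i :=
  sub_nonneg.2 (hf.monotone.le_update i (by simp [splice]))

lemma IsReward.marg_le_one {f : Action n k → ℝ} (hf : IsReward f) (x : Action n k) (j : Fin n)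
    (i : Fin (k + 1)) : marg f x j i ≤ 1 := by
  have h1 := (hf.mem_Icc (Function.update (splice x 0 j) j i)).2
  have h2 := (hf.mem_Icc (splice x 0 j)).1
  unfold marg; linarith

/-- Marginal gains of a `k`-submodular function decrease. -/
lemma IsKSubmodular.sub_update_le {f : Action n k → ℝ} (hf : IsKSubmodular f) (x o : Action n k)
    (j : Fin n) (i : Fin (k + 1)) :
    f (Function.update (splice x o j) j i) - f (Function.update (splice x o j) j 0) ≤
      marg f x j i := by
  -- The first vector vanishes above `j` and the second at `j`, so the join has `i` at `j` and `o`
  -- above, while the meet is the bare prefix.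
  have h := hf (Function.update (splice x 0 j) j i) (Function.update (splice x o j) j 0)
  have e1 : join (Function.update (splice x 0 j) j i) (Function.update (splice x o j) j 0) =
      Function.update (splice x o j) j i := by
    funext l
    by_cases h : l = j
    · subst h; simp [join, joinVal_zero]
    · simp only [join, Function.update_of_ne h, splice]
      split_ifs <;> simp [joinVal_self, zero_joinVal]
  have e2 : meet (Function.update (splice x 0 j) j i) (Function.update (splice x o j) j 0) =
      splice x 0 j := by
    funext l
    by_cases h : l = j
    · subst h; simp [meet, meetVal_zero, splice]
    · simp only [meet, Function.update_of_ne h, splice]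
      split_ifs <;> simp [meetVal_self, zero_meetVal]
  rw [e1, e2] at h
  unfold marg; linarith

/-- Go through the vector with coordinate `j` erased: submodularity bounds the loss from erasing `o
j`, and by monotonicity writing `x j` afterwards costs nothing. -/
lemma IsReward.splice_sub_le {f : Action n k → ℝ} (hf : IsReward f) (x o : Action n k)
    (j : Fin n) :
    f (splice x o j) - f (splice x o (j + 1)) ≤
      if o j = 0 ∨ o j = x j then 0 else marg f x j (o j) := by
  have h1 := hf.submodular.sub_update_le x o j (o j)
  have h2 : f (Function.update (splice x o j) j 0) ≤ f (splice x o (j + 1)) := by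
    have := hf.monotone.le_update (z := Function.update (splice x o j) j 0) (j := j) (x j)
      (by simp)
    rwa [Function.update_idem, update_splice] at this
  rw [update_splice_right] at h1
  split_ifs with h
  · rcases h with h | h
    · rw [← h, update_splice_right] at h2; linarith
    · rw [← update_splice, ← h, update_splice_right]; simp
  · linarith

/-- The number `1 - 1/k`. -/
def slack (k : ℕ) : ℝ := 1 - 1 / (k : ℝ)

lemma slack_nonneg {k : ℕ} (hk : 1 ≤ k) : 0 ≤ slack k := by
  have : (1 : ℝ) ≤ k := by exact_mod_cast hk
  unfold slack
  rw [sub_nonneg, div_le_one (by linarith)]; exact this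

lemma slack_le_one (k : ℕ) : slack k ≤ 1 := by
  unfold slack; linarith [show (0 : ℝ) ≤ 1 / (k : ℝ) by positivity]

/-- The change of the regret against colour `i` at coordinate `j` when `x` is played. -/
def increment (f : Action n k → ℝ) (x : Action n k) (j : Fin n) (i : ℕ) : ℝ :=
  marg f x j (Fin.ofNat (k + 1) i) - slack k * marg f x j (x j)
    - if i = x j then marg f x j (x j) else 0

lemma sum_fin_telescope (g : ℕ → ℝ) (n : ℕ) : ∑ j : Fin n, (g j - g (j + 1)) = g 0 - g n := by
  rw [Fin.sum_univ_eq_sum_range (fun j => g j - g (j + 1)), Finset.sum_range_sub']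

lemma IsReward.sub_le_sum_increment {f : Action n k → ℝ} (hf : IsReward f) (hk : 1 ≤ k)
    (x o : Action n k) :
    f o - f x - slack k * f x ≤ ∑ j : Fin n, if o j = 0 then 0 else increment f x j (o j) := by
  have h1 : f o - f x = ∑ j : Fin n, (f (splice x o j) - f (splice x o (j + 1))) := by
    rw [sum_fin_telescope (fun j => f (splice x o j)), splice_zero, splice_full]
  have h2 : f x - f 0 = ∑ j : Fin n, marg f x j (x j) := by
    have := sum_fin_telescope (fun j => f (splice x 0 j)) n
    rw [splice_zero, splice_full] at this
    rw [← neg_sub, ← this, ← Finset.sum_neg_distrib]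
    refine Finset.sum_congr rfl fun j _ => ?_
    rw [marg, update_splice]; ring
  -- The telescoped marginals give `f x - f 0`; nonnegativity of `f 0` enters here.
  have h3 : slack k * ∑ j : Fin n, marg f x j (x j) ≤ slack k * f x :=
    mul_le_mul_of_nonneg_left (by linarith [(hf.mem_Icc 0).1]) (slack_nonneg hk)
  have h4 : ∑ j : Fin n, (f (splice x o j) - f (splice x o (j + 1))) -
      slack k * ∑ j : Fin n, marg f x j (x j) ≤
      ∑ j : Fin n, if o j = 0 then 0 else increment f x j (o j) := by
    rw [Finset.mul_sum, ← Finset.sum_sub_distrib]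
    refine Finset.sum_le_sum fun j _ => ?_
    have h := hf.splice_sub_le x o j
    have hs := mul_nonneg (slack_nonneg hk) (hf.marg_nonneg x j (x j))
    by_cases h0 : o j = 0
    · simp only [h0, true_or, if_true] at h ⊢; linarith
    · by_cases hx : o j = x j
      · simp only [hx, or_true, if_true] at h
        rw [if_neg h0, increment, if_pos (by rw [hx]), hx, Fin.ofNat_val_eq_self]
        linarith
      · rw [if_neg (by tauto)] at h
        rw [if_neg h0, increment, if_neg (fun e => hx (Fin.ext e)), Fin.ofNat_val_eq_self]
        linarith
  linarith

lemma IsReward.abs_increment_le {f : Action n k → ℝ} (hf : IsReward f) (hk : 1 ≤ k)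
    (x : Action n k) (j : Fin n) (i : ℕ) : |increment f x j i| ≤ 1 := by
  have a0 := hf.marg_nonneg x j (Fin.ofNat (k + 1) i)
  have a1 := hf.marg_le_one x j (Fin.ofNat (k + 1) i)
  have b0 := hf.marg_nonneg x j (x j)
  have b1 := hf.marg_le_one x j (x j)
  have s0 := slack_nonneg hk
  have s1 := slack_le_one k
  have m0 := mul_nonneg s0 b0
  have m1 := mul_le_one₀ s1 b0 b1
  rw [abs_le, increment]
  split_ifs with h
  · rw [h, Fin.ofNat_val_eq_self]; constructor <;> linarith
  · constructor <;> linarith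

end Offline

/-! ### Blackwell's strategy for one coordinate -/

section Selection

variable (k : ℕ) (ρ : ℕ → ℝ)

/-- The sum of the positive parts of the regrets `ρ 1, …, ρ k`. -/
def total : ℝ := ∑ i ∈ Finset.range k, max (ρ (i + 1)) 0

/-- The least probability with which colour `i + 1` is to be played. -/
def prob (i : ℕ) : ℝ :=
  max (ρ (i + 1)) 0 / (max (ρ (i + 1)) 0 + slack k * total k ρ)

def cumProb (m : ℕ) : ℝ := ∑ i ∈ Finset.range m, prob k ρ i

/-- The colour in `{1, …, k}` that is played when the random number is `u`. -/
def pick (u : ℝ) : ℕ :=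
  1 + ∑ m ∈ Finset.range (k - 1), if cumProb k ρ (m + 1) ≤ u then 1 else 0

variable {k ρ}

lemma one_le_pick (u : ℝ) : 1 ≤ pick k ρ u := Nat.le_add_right _ _

lemma pick_le (hk : 1 ≤ k) (u : ℝ) : pick k ρ u ≤ k := by
  have : ∑ m ∈ Finset.range (k - 1), (if cumProb k ρ (m + 1) ≤ u then 1 else 0) ≤
      ∑ m ∈ Finset.range (k - 1), 1 := Finset.sum_le_sum fun m _ => by split_ifs <;> simp
  rw [Finset.sum_const, Finset.card_range, smul_eq_mul, mul_one] at this
  unfold pick; omega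

lemma total_nonneg : 0 ≤ total k ρ := Finset.sum_nonneg fun _ _ => le_max_right _ _

lemma prob_nonneg (hk : 1 ≤ k) (i : ℕ) : 0 ≤ prob k ρ i :=
  div_nonneg (le_max_right _ _)
    (add_nonneg (le_max_right _ _) (mul_nonneg (slack_nonneg hk) total_nonneg))

lemma cumProb_mono (hk : 1 ≤ k) : Monotone (cumProb k ρ) :=
  monotone_nat_of_le_succ fun m => by
    rw [cumProb, cumProb, Finset.sum_range_succ]; linarith [prob_nonneg (ρ := ρ) hk m]

/-- The equation that cancels the drift. It survives division by zero, since a vanishing denominator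
forces the numerator to vanish. -/
lemma prob_mul (hk : 1 ≤ k) (i : ℕ) :
    prob k ρ i * (max (ρ (i + 1)) 0 + slack k * total k ρ) = max (ρ (i + 1)) 0 := by
  have h1 : 0 ≤ max (ρ (i + 1)) 0 := le_max_right _ _
  have h2 : 0 ≤ slack k * total k ρ := mul_nonneg (slack_nonneg hk) total_nonneg
  by_cases h : max (ρ (i + 1)) 0 + slack k * total k ρ = 0
  · rw [h, mul_zero]; linarith
  · exact div_mul_cancel₀ _ h

/-- With `v` the share of a colour in `W`, the concave function `v / (v + c)` lies below its tangent
at `v = 1/k = 1 - c`, which is `(1 - c)^2 + c * v`. The shares sum to `1`, so the tangents sum to `k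
* (1/k)^2 + c = 1`. -/
lemma cumProb_le_one (hk : 1 ≤ k) : cumProb k ρ k ≤ 1 := by
  have hk' : (0 : ℝ) < k := by exact_mod_cast hk
  rcases (total_nonneg (k := k) (ρ := ρ)).eq_or_lt with h | h
  · have : ∀ i ∈ Finset.range k, prob k ρ i = 0 := fun i hi => by
      have := (Finset.sum_eq_zero_iff_of_nonneg (fun _ _ => le_max_right _ _)).1 h.symm i hi
      simp [prob, this]
    rw [cumProb, Finset.sum_eq_zero this]; exact zero_le_one
  · set W := total k ρ with hW
    set c := slack k with hc
    have c0 : 0 ≤ c := slack_nonneg hk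
    have hck : 1 / (k : ℝ) = 1 - c := by rw [hc, slack]; ring
    have bound : ∀ i, prob k ρ i ≤ (1 - c) ^ 2 + c * (max (ρ (i + 1)) 0 / W) := fun i => by
      have hw : 0 ≤ max (ρ (i + 1)) 0 := le_max_right _ _
      unfold prob
      rw [← hW, ← hc]
      generalize max (ρ (i + 1)) 0 = w at hw ⊢
      obtain ⟨v, rfl⟩ : ∃ v, w = v * W := ⟨w / W, by field_simp⟩
      have hv : 0 ≤ v := nonneg_of_mul_nonneg_left hw h
      rw [mul_div_cancel_right₀ _ h.ne', ← add_mul, mul_div_mul_right _ _ h.ne']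
      refine div_le_of_le_mul₀ (by linarith) (by positivity) ?_
      -- After clearing the denominator, the difference of the two sides is exactly this square
      -- times `c`.
      nlinarith [mul_nonneg c0 (sq_nonneg (v - (1 - c)))]
    calc cumProb k ρ k ≤ ∑ i ∈ Finset.range k, ((1 - c) ^ 2 + c * (max (ρ (i + 1)) 0 / W)) :=
          Finset.sum_le_sum fun i _ => bound i
      _ = k * (1 - c) ^ 2 + c * (W / W) := by
          rw [Finset.sum_add_distrib, ← Finset.mul_sum, ← Finset.sum_div]
          simp [hW, total]
      _ = 1 := by
          rw [div_self h.ne', ← hck, show c = 1 - 1 / (k : ℝ) by rw [hck]; ring]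
          field_simp; ring

/-- Only `k - 1` thresholds are counted, so colour `k` also receives all the mass that `prob` leaves
unassigned. -/
lemma pick_eq (hk : 1 ≤ k) {i : ℕ} (hi : i < k) {u : ℝ} (h1 : cumProb k ρ i ≤ u)
    (h2 : u < cumProb k ρ (i + 1)) : pick k ρ u = i + 1 := by
  have : ∀ m ∈ Finset.range (k - 1), (if cumProb k ρ (m + 1) ≤ u then 1 else 0) =
      if m < i then 1 else 0 := fun m _ => by
    have hm := @cumProb_mono k ρ hk
    by_cases h : m < i
    · rw [if_pos h, if_pos ((hm h).trans h1)]
    · rw [if_neg h, if_neg (not_le.2 (h2.trans_le (hm (by omega))))]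
  rw [pick, Finset.sum_congr rfl this, ← Finset.card_filter, add_comm]
  congr 1
  have : (Finset.range (k - 1)).filter (· < i) = Finset.range i := by
    ext m; simp only [Finset.mem_filter, Finset.mem_range]; omega
  rw [this, Finset.card_range]

end Selection

/-! ### The history of play -/

section History

variable {n k : ℕ} (F : Adversary n k)

/-- The regret against colour `i` at coordinate `j`, after the given history. -/
def regretVec : List (Action n k) → Fin n → ℕ → ℝ
  | [], _, _ => 0
  | x :: h, j, i => regretVec h j i + increment (F h) x j i

def cumReward (o : Action n k) : List (Action n k) → ℝ
  | [] => 0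
  | _ :: h => cumReward o h + F h o

def cumGain : List (Action n k) → ℝ
  | [] => 0
  | x :: h => cumGain h + F h x

/-- The squared distance of the regret vector from the negative orthant. -/
def potential (h : List (Action n k)) (j : Fin n) : ℝ :=
  ∑ i ∈ Finset.range k, max (regretVec F h j (i + 1)) 0 ^ 2

/-- The inner product of the positive part of the regret vector with its change. -/
def drift (h : List (Action n k)) (j : Fin n) (x : Action n k) : ℝ :=
  ∑ i ∈ Finset.range k, max (regretVec F h j (i + 1)) 0 * increment (F h) x j (i + 1)

variable {F}

lemma potential_nonneg (h : List (Action n k)) (j : Fin n) : 0 ≤ potential F h j :=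
  Finset.sum_nonneg fun _ _ => sq_nonneg _

lemma regretVec_le_sqrt (h : List (Action n k)) (j : Fin n) {i : Fin (k + 1)} (hi : i ≠ 0) :
    regretVec F h j i ≤ Real.sqrt (potential F h j) := by
  refine (le_max_left _ 0).trans (Real.le_sqrt_of_sq_le ?_)
  have hi' : (i : ℕ) ≠ 0 := fun e => hi (Fin.ext e)
  have := Finset.single_le_sum (f := fun i => max (regretVec F h j (i + 1)) 0 ^ 2)
    (fun _ _ => sq_nonneg _) (Finset.mem_range.2 (show (i : ℕ) - 1 < k by omega))
  simpa [potential, show (i : ℕ) - 1 + 1 = i by omega] using this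

lemma cumReward_sub_le_sum_regretVec (hk : 1 ≤ k) (hF : ∀ h, IsReward (F h)) (o : Action n k)
    (h : List (Action n k)) :
    cumReward F o h - cumGain F h - slack k * cumGain F h ≤
      ∑ j : Fin n, if o j = 0 then 0 else regretVec F h j (o j) := by
  induction h with
  | nil => simp [cumReward, cumGain, regretVec]
  | cons x h ih =>
    have := (hF h).sub_le_sum_increment hk x o
    have e : (∑ j : Fin n, if o j = 0 then 0 else regretVec F (x :: h) j (o j)) =
        (∑ j : Fin n, if o j = 0 then 0 else regretVec F h j (o j)) +
        ∑ j : Fin n, if o j = 0 then 0 else increment (F h) x j (o j) := by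
      rw [← Finset.sum_add_distrib]
      refine Finset.sum_congr rfl fun j _ => ?_
      split_ifs
      · simp
      · rfl
    rw [e]; simp only [cumReward, cumGain]; linarith

/-- The regret of a history is bounded by the distances of the regret vectors from the negative
orthant. -/
lemma regret_le_sum_sqrt (hk : 1 ≤ k) (hF : ∀ h, IsReward (F h)) (o : Action n k)
    (h : List (Action n k)) :
    (k : ℝ) / (2 * k - 1) * cumReward F o h - cumGain F h ≤
      ∑ j : Fin n, Real.sqrt (potential F h j) := by
  have h1 := cumReward_sub_le_sum_regretVec hk hF o h
  have h2 : (∑ j : Fin n, if o j = 0 then 0 else regretVec F h j (o j)) ≤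
      ∑ j : Fin n, Real.sqrt (potential F h j) := Finset.sum_le_sum fun j _ => by
    split_ifs with h0
    · exact Real.sqrt_nonneg _
    · exact regretVec_le_sqrt h j h0
  have hk' : (1 : ℝ) ≤ k := by exact_mod_cast hk
  have hs : 0 ≤ ∑ j : Fin n, Real.sqrt (potential F h j) :=
    Finset.sum_nonneg fun _ _ => Real.sqrt_nonneg _
  have e : (k : ℝ) / (2 * k - 1) * cumReward F o h - cumGain F h =
      (k : ℝ) / (2 * k - 1) * (cumReward F o h - cumGain F h - slack k * cumGain F h) := by
    have h0 : (2 * k - 1 : ℝ) ≠ 0 := by linarith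
    -- The approximation ratio is the inverse of `1 + slack k`.
    have hα : (k : ℝ) / (2 * k - 1) * (1 + slack k) = 1 := by
      have : (k : ℝ) ≠ 0 := by linarith
      rw [slack, div_mul_eq_mul_div, div_eq_one_iff_eq h0]; field_simp; ring
    linear_combination (cumGain F h) * hα
  rw [e]
  calc _ ≤ (k : ℝ) / (2 * k - 1) * ∑ j : Fin n, Real.sqrt (potential F h j) :=
        mul_le_mul_of_nonneg_left (h1.trans h2) (div_nonneg (by linarith) (by linarith))
    -- The ratio is at most `1` because `k ≥ 1`.
    _ ≤ 1 * ∑ j : Fin n, Real.sqrt (potential F h j) :=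
        mul_le_mul_of_nonneg_right (div_le_one_of_le₀ (by linarith) (by linarith)) hs
    _ = _ := one_mul _

lemma max_add_sq_le (a b : ℝ) : max (a + b) 0 ^ 2 ≤ max a 0 ^ 2 + 2 * (max a 0 * b) + b ^ 2 := by
  rcases max_cases a 0 with ⟨h, _⟩ | ⟨h, _⟩ <;> rcases max_cases (a + b) 0 with ⟨h', _⟩ | ⟨h', _⟩ <;>
    rw [h, h'] <;> nlinarith [sq_nonneg (a + b), sq_nonneg b]

lemma potential_cons_le (hk : 1 ≤ k) (hF : ∀ h, IsReward (F h)) (x : Action n k)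
    (h : List (Action n k)) (j : Fin n) :
    potential F (x :: h) j ≤ potential F h j + 2 * drift F h j x + k := by
  have : ∀ i ∈ Finset.range k, max (regretVec F (x :: h) j (i + 1)) 0 ^ 2 ≤
      max (regretVec F h j (i + 1)) 0 ^ 2 +
        2 * (max (regretVec F h j (i + 1)) 0 * increment (F h) x j (i + 1)) + 1 := fun i _ => by
    refine (max_add_sq_le _ _).trans (add_le_add_right ?_ _)
    exact (sq_le_one_iff_abs_le_one _).2 ((hF h).abs_increment_le hk x j _)
  refine (Finset.sum_le_sum this).trans (le_of_eq ?_)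
  rw [Finset.sum_add_distrib, Finset.sum_add_distrib, ← Finset.mul_sum]
  simp [potential, drift]

/-- Isolates the dependence on the played colour: its marginal is weighted by the denominator of
`prob`. -/
lemma drift_eq (h : List (Action n k)) (j : Fin n) (x : Action n k) (hx : x j ≠ 0) :
    drift F h j x =
      (∑ i ∈ Finset.range k,
        max (regretVec F h j (i + 1)) 0 * marg (F h) x j (Fin.ofNat (k + 1) (i + 1))) -
      (max (regretVec F h j (x j)) 0 + slack k * total k (regretVec F h j)) *
        marg (F h) x j (x j) := by
  have hx' : (x j : ℕ) ≠ 0 := fun e => hx (Fin.ext e)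
  have e : ∀ i ∈ Finset.range k,
      max (regretVec F h j (i + 1)) 0 * increment (F h) x j (i + 1) =
      max (regretVec F h j (i + 1)) 0 * marg (F h) x j (Fin.ofNat (k + 1) (i + 1)) -
      max (regretVec F h j (i + 1)) 0 * (slack k * marg (F h) x j (x j)) -
      if i = (x j : ℕ) - 1 then max (regretVec F h j (x j)) 0 * marg (F h) x j (x j) else 0 :=
    fun i _ => by
      rw [increment]
      by_cases hi : i + 1 = (x j : ℕ)
      · rw [if_pos hi, if_pos (by omega), hi]; ring
      · rw [if_neg hi, if_neg (by omega)]; ring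
  rw [drift, Finset.sum_congr rfl e, Finset.sum_sub_distrib, Finset.sum_sub_distrib,
    Finset.sum_ite_eq', if_pos (Finset.mem_range.2 (by omega)), ← Finset.sum_mul, total]
  ring

end History

/-! ### The distribution of the play -/

section PickLaw

variable {k : ℕ} {ρ : ℕ → ℝ}

lemma measurable_pick : Measurable (pick k ρ) := by
  unfold pick
  refine measurable_const.add (Finset.measurable_sum _ fun m _ => ?_)
  exact Measurable.ite measurableSet_Ici measurable_const measurable_const

lemma volume_unitInterval_Ico {a b : ℝ} (ha : 0 ≤ a) (hb : b ≤ 1) :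
    volume {u : unitInterval | a ≤ (u : ℝ) ∧ (u : ℝ) < b} = ENNReal.ofReal (b - a) := by
  have : (Subtype.val '' {u : unitInterval | a ≤ (u : ℝ) ∧ (u : ℝ) < b}) = Set.Ico a b := by
    ext v
    simp only [Set.mem_image, Set.mem_ofPred_eq, Set.mem_Ico]
    exact ⟨by rintro ⟨u, hu, rfl⟩; exact hu,
      fun hv => ⟨⟨v, by linarith [hv.1], by linarith [hv.2]⟩, hv, rfl⟩⟩
  rw [unitInterval.volume_apply, this, Real.volume_Ico]

lemma prob_le_measure_pick (hk : 1 ≤ k) {i : ℕ} (hi : i < k) :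
    prob k ρ i ≤ (volume : Measure unitInterval).real {u | pick k ρ u = i + 1} := by
  have hm := cumProb_mono (ρ := ρ) hk
  have h0 : 0 ≤ cumProb k ρ i := Finset.sum_nonneg fun _ _ => prob_nonneg hk _
  have h1 : cumProb k ρ (i + 1) ≤ 1 := (hm hi).trans (cumProb_le_one hk)
  have e : prob k ρ i = cumProb k ρ (i + 1) - cumProb k ρ i := by
    simp [cumProb, Finset.sum_range_succ]
  have hv : (volume : Measure unitInterval).real
      {u : unitInterval | cumProb k ρ i ≤ (u : ℝ) ∧ (u : ℝ) < cumProb k ρ (i + 1)} =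
      prob k ρ i := by
    rw [Measure.real, volume_unitInterval_Ico h0 h1, ← e, ENNReal.toReal_ofReal (prob_nonneg hk i)]
  rw [← hv]
  exact measureReal_mono fun u hu => pick_eq hk hi hu.1 hu.2

/-- An inequality suffices and is all that holds, as colour `k` may exceed its prescribed
probability; this is where nonnegative payoffs are needed. -/
lemma sum_prob_mul_le_integral_pick (hk : 1 ≤ k) (b : ℕ → ℝ) (hb : ∀ i, 0 ≤ b i) :
    ∑ i ∈ Finset.range k, prob k ρ i * b (i + 1) ≤ ∫ u : unitInterval, b (pick k ρ u) := by
  have hms : ∀ i, MeasurableSet {u : unitInterval | pick k ρ u = i + 1} := fun i =>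
    (measurable_pick.comp measurable_subtype_coe) (measurableSet_singleton (i + 1))
  have e : (fun u : unitInterval => b (pick k ρ u)) = fun u : unitInterval =>
      ∑ i ∈ Finset.range k,
        Set.indicator {u : unitInterval | pick k ρ u = i + 1} (fun _ => b (i + 1)) u := by
    funext u
    have h1 := one_le_pick (k := k) (ρ := ρ) u
    have h2 := pick_le (ρ := ρ) hk u
    rw [Finset.sum_eq_single (pick k ρ u - 1)]
    · rw [Set.indicator_of_mem (by simp only [Set.mem_ofPred_eq]; omega), Nat.sub_add_cancel h1]
    · intro i _ hi
      exact Set.indicator_of_notMem (by simp only [Set.mem_ofPred_eq]; omega) _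
    · intro h; exact absurd (Finset.mem_range.2 (by omega)) h
  rw [e, integral_finsetSum _ fun i _ => (integrable_const _).indicator (hms i)]
  refine Finset.sum_le_sum fun i hi => ?_
  rw [integral_indicator_const _ (hms i), smul_eq_mul]
  exact mul_le_mul_of_nonneg_right (prob_le_measure_pick hk (Finset.mem_range.1 hi)) (hb _)

end PickLaw

/-! ### Expected regret of the idealized strategy -/

section Expectation

variable {n k : ℕ} (F : Adversary n k)

instance : IsProbabilityMeasure tapeMeasure := by unfold tapeMeasure; infer_instance

/-- Histories are countably many, so every function of the history may be taken measurable and the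
adversary needs no measurability assumption. -/
instance : MeasurableSpace (List (Action n k)) := ⊤

instance : DiscreteMeasurableSpace (List (Action n k)) := ⟨fun _ => trivial⟩

/-- The action that is played after the given history. -/
def playAction (h : List (Action n k)) (ω : Tape) : Action n k := fun j =>
  Fin.ofNat (k + 1) (pick k (regretVec F h j) (ω (h.length * n + j)))

/-- The actions of the first `t` rounds, the most recent one first. -/
def hist (ω : Tape) : ℕ → List (Action n k)
  | 0 => []
  | t + 1 => playAction F (hist ω t) ω :: hist ω t

lemma length_hist (ω : Tape) (t : ℕ) : (hist F ω t).length = t := by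
  induction t with
  | zero => rfl
  | succ t ih => simp [hist, ih]

variable {F}

lemma hist_congr {ω ω' : Tape} {t : ℕ} (h : ∀ i < t * n, ω i = ω' i) :
    hist F ω t = hist F ω' t := by
  induction t with
  | zero => rfl
  | succ t ih =>
    have e := ih fun i hi => h i (hi.trans_le (Nat.mul_le_mul_right _ (Nat.le_succ t)))
    rw [hist, hist, e]
    congr 1
    funext j
    rw [playAction, playAction, length_hist, h]
    have := j.2
    rw [Nat.succ_mul]; omega

lemma measurable_playAction (h : List (Action n k)) : Measurable (playAction F h) := by
  refine measurable_pi_iff.2 fun j => ?_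
  have h1 : Measurable fun ω : Tape => (ω (h.length * n + j) : ℝ) :=
    measurable_subtype_coe.comp (measurable_pi_apply _)
  have h2 : Measurable fun i : ℕ => Fin.ofNat (k + 1) i := .of_discrete
  have h3 : Measurable (pick k (regretVec F h j)) := measurable_pick
  simp only [playAction]
  exact h2.comp (h3.comp h1)

lemma measurable_hist (t : ℕ) : Measurable fun ω => hist F ω t := by
  induction t with
  | zero => exact measurable_const
  | succ t ih =>
    have : Measurable fun p : List (Action n k) × Tape => playAction F p.1 p.2 :: p.1 :=
      measurable_from_prod_countable_right fun h => by
        have h1 : Measurable fun x : Action n k => x :: h := .of_discrete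
        exact h1.comp (measurable_playAction h)
    have h2 : Measurable fun ω => (hist F ω t, ω) := ih.prodMk measurable_id
    have h3 := this.comp h2
    simp only [Function.comp_def] at h3
    simp only [hist]
    exact h3

/-- The history after `t` rounds takes finitely many values, so `G` is bounded on them. -/
lemma integrable_hist (G : List (Action n k) → ℝ) (t : ℕ) :
    Integrable (fun ω => G (hist F ω t)) tapeMeasure := by
  have hfin : (G '' {l : List (Action n k) | l.length = t}).Finite :=
    (List.finite_length_eq _ _).image G
  obtain ⟨C, hC⟩ := (Metric.isBounded_iff_subset_closedBall 0).1 hfin.isBounded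
  refine Integrable.of_bound
    ((Measurable.of_discrete (f := G)).comp (measurable_hist t)).aestronglyMeasurable C
    (Filter.Eventually.of_forall fun ω => ?_)
  exact mem_closedBall_zero_iff.1 (hC ⟨_, length_hist F ω t, rfl⟩)

lemma integrable_hist_playAction (G : List (Action n k) → Action n k → ℝ) (t : ℕ) :
    Integrable (fun ω => G (hist F ω t) (playAction F (hist F ω t) ω)) tapeMeasure :=
  -- The action of round `t` is the head of the next history; the default `0` is never used.
  integrable_hist (fun l => G l.tail (l.head?.getD 0)) (t + 1)

/-- A random variable that is determined by the first `m` draws is independent of the next one. -/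
lemma indepFun_draw {β : Type*} [MeasurableSpace β] {X : Tape → β} (hX : Measurable X) (m : ℕ)
    (h : ∀ ω ω' : Tape, (∀ i < m, ω i = ω' i) → X ω = X ω') :
    ProbabilityTheory.IndepFun X (fun ω => ω m) tapeMeasure := by
  have hi := ProbabilityTheory.iIndepFun_infinitePi
    (P := fun _ : ℕ => (volume : Measure unitInterval)) (X := fun _ u => u)
    (fun _ => measurable_id)
  have hj := hi.indepFun_finset (Finset.range m) {m} (by simp) fun i => measurable_pi_apply i
  -- Padding the first `m` draws by `0` shows that `X` factors through them.
  let ext : (Finset.range m → unitInterval) → Tape := fun r i =>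
    if hi : i ∈ Finset.range m then r ⟨i, hi⟩ else 0
  have hext : Measurable ext := measurable_pi_iff.2 fun i => by
    by_cases hi : i ∈ Finset.range m
    · simpa only [ext, dif_pos hi] using measurable_pi_apply _
    · simpa only [ext, dif_neg hi] using measurable_const
  have := hj.comp (hX.comp hext)
    (measurable_pi_apply (⟨m, Finset.mem_singleton_self m⟩ : ({m} : Finset ℕ)))
  convert! this using 1
  funext ω
  exact h _ _ fun i hi => by simp [ext, hi]

/-- The drift at `j` ignores the coordinates above `j`, hence all later draws. -/
lemma drift_congr {h : List (Action n k)} {j : Fin n} {x x' : Action n k}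
    (h1 : splice x 0 j = splice x' 0 j) (h2 : x j = x' j) : drift F h j x = drift F h j x' := by
  unfold drift increment marg
  rw [h1, h2]

lemma splice_update_splice (x : Action n k) (j : Fin n) (i : Fin (k + 1)) :
    splice (Function.update (splice x 0 j) j i) 0 j = splice x 0 j := by
  funext l
  by_cases hl : l = j
  · subst hl; simp [splice]
  · simp only [splice, Function.update_of_ne hl]; split_ifs <;> rfl

/-- Blackwell's condition with the history and the prefix frozen: by `prob_mul`, the constant part
of the drift is the prescribed average of `b`, which the true average dominates. -/
lemma integral_drift_pick_nonpos (hk : 1 ≤ k) (hF : ∀ h, IsReward (F h)) (h : List (Action n k))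
    (s : Action n k) (j : Fin n) :
    ∫ u : unitInterval, drift F h j (Function.update (splice s 0 j) j
      (Fin.ofNat (k + 1) (pick k (regretVec F h j) u))) ≤ 0 := by
  set ρ := regretVec F h j with hρ
  let y : ℕ → ℝ := fun i => marg (F h) s j (Fin.ofNat (k + 1) i)
  let b : ℕ → ℝ := fun i => (max (ρ i) 0 + slack k * total k ρ) * y i
  have hb : ∀ i, 0 ≤ b i := fun i =>
    mul_nonneg (add_nonneg (le_max_right _ _) (mul_nonneg (slack_nonneg hk) total_nonneg))
      ((hF h).marg_nonneg _ _ _)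
  have hy : ∀ i i', marg (F h) (Function.update (splice s 0 j) j i') j i = marg (F h) s j i :=
    fun i i' => by
      unfold marg; rw [splice_update_splice]
  have e : ∀ u : unitInterval, drift F h j (Function.update (splice s 0 j) j
      (Fin.ofNat (k + 1) (pick k ρ u))) =
      ∑ i ∈ Finset.range k, prob k ρ i * b (i + 1) - b (pick k ρ u) := fun u => by
    have hv : ((Fin.ofNat (k + 1) (pick k ρ u) : Fin (k + 1)) : ℕ) = pick k ρ u := by
      have := pick_le (ρ := ρ) hk u
      simp [Fin.ofNat, Nat.mod_eq_of_lt (Nat.lt_succ_of_le this)]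
    rw [drift_eq]
    · simp only [Function.update_self, hv, hy]
      congr 1
      refine Finset.sum_congr rfl fun i _ => ?_
      rw [← mul_assoc, prob_mul hk]
    · rw [Function.update_self]
      intro h0
      have := one_le_pick (k := k) (ρ := ρ) u
      rw [h0] at hv
      simp at hv; omega
  simp only [e]
  have hint : Integrable (fun u : unitInterval => b (pick k ρ u)) volume := by
    have hfin : (b '' Set.Iic k).Finite := (Set.finite_Iic k).image b
    obtain ⟨C, hC⟩ := (Metric.isBounded_iff_subset_closedBall 0).1 hfin.isBounded
    refine Integrable.of_bound ((Measurable.of_discrete (f := b)).comp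
      (measurable_pick.comp measurable_subtype_coe)).aestronglyMeasurable C
      (Filter.Eventually.of_forall fun u => ?_)
    exact mem_closedBall_zero_iff.1 (hC ⟨_, pick_le hk u, rfl⟩)
  rw [integral_sub (integrable_const _) hint]
  have := sum_prob_mul_le_integral_pick (ρ := ρ) hk b hb
  simpa using this

lemma integral_drift_nonpos (hk : 1 ≤ k) (hF : ∀ h, IsReward (F h)) (t : ℕ) (j : Fin n) :
    ∫ ω, drift F (hist F ω t) j (playAction F (hist F ω t) ω) ∂tapeMeasure ≤ 0 := by
  let X : Tape → List (Action n k) × Action n k := fun ω =>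
    (hist F ω t, splice (playAction F (hist F ω t) ω) 0 j)
  let g : (List (Action n k) × Action n k) × unitInterval → ℝ := fun p =>
    drift F p.1.1 j (Function.update (splice p.1.2 0 j) j
      (Fin.ofNat (k + 1) (pick k (regretVec F p.1.1 j) p.2)))
  have hX : Measurable X := by
    have h1 : Measurable fun ω => hist F ω (t + 1) := measurable_hist _
    simp only [X]
    exact (Measurable.of_discrete (f := fun l : List (Action n k) =>
      (l.tail, splice (l.head?.getD 0) 0 (j : ℕ)))).comp h1
  have hg : Measurable g := measurable_from_prod_countable_right fun x => by
    have h1 : Measurable fun i : ℕ => drift F x.1 j (Function.update (splice x.2 0 j) j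
      (Fin.ofNat (k + 1) i)) := .of_discrete
    have h2 : Measurable fun u : unitInterval => pick k (regretVec F x.1 j) u :=
      measurable_pick.comp measurable_subtype_coe
    exact h1.comp h2
  -- `X` uses only the draws before index `t * n + j`: those of earlier rounds and of the
  -- coordinates below `j`. The joint law is then a product, and Fubini reduces the claim to a
  -- frozen `X`.
  have hind := indepFun_draw hX (t * n + j) fun ω ω' hω => by
    have e : hist F ω t = hist F ω' t := hist_congr fun i hi => hω i (by omega)
    simp only [X, e, Prod.mk.injEq, true_and]
    funext l
    simp only [splice]
    split_ifs with hl
    · rw [playAction, playAction, length_hist, hω _ (by omega)]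
    · rfl
  have hm : Measurable fun ω : Tape => ω (t * n + j) := measurable_pi_apply _
  have hmap := (ProbabilityTheory.indepFun_iff_map_prod_eq_prod_map_map hX.aemeasurable
    hm.aemeasurable).1 hind
  have hlaw : tapeMeasure.map (fun ω : Tape => ω (t * n + j)) = volume :=
    Measure.infinitePi_map_eval _ _
  rw [hlaw] at hmap
  have e : ∀ ω, drift F (hist F ω t) j (playAction F (hist F ω t) ω) =
      g (X ω, ω (t * n + j)) := fun ω => by
    refine drift_congr ?_ ?_
    · rw [splice_update_splice, splice_splice]
    · rw [Function.update_self, playAction, length_hist]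
  have hint := integrable_hist_playAction (F := F) (fun h x => drift F h j x) t
  simp only [e] at hint ⊢
  have hXm : Measurable fun ω : Tape => (X ω, ω (t * n + j)) := hX.prodMk hm
  have hint' := (integrable_map_measure hg.aestronglyMeasurable hXm.aemeasurable).2 hint
  rw [← integral_map (φ := fun ω : Tape => (X ω, ω (t * n + j))) hXm.aemeasurable
    hg.aestronglyMeasurable, hmap]
  rw [hmap] at hint'
  rw [integral_prod _ hint']
  exact integral_nonpos fun x => integral_drift_pick_nonpos hk hF x.1 x.2 j

lemma integral_potential_le (hk : 1 ≤ k) (hF : ∀ h, IsReward (F h)) (t : ℕ) (j : Fin n) :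
    ∫ ω, potential F (hist F ω t) j ∂tapeMeasure ≤ k * t := by
  induction t with
  | zero => simp [hist, potential, regretVec]
  | succ t ih =>
    have i1 := integrable_hist (F := F) (fun h => potential F h j) t
    have i2 := integrable_hist_playAction (F := F) (fun h x => drift F h j x) t
    calc ∫ ω, potential F (hist F ω (t + 1)) j ∂tapeMeasure
        ≤ ∫ ω, (potential F (hist F ω t) j +
            2 * drift F (hist F ω t) j (playAction F (hist F ω t) ω) + k) ∂tapeMeasure :=
          integral_mono (integrable_hist (fun h => potential F h j) (t + 1))
            ((i1.add (i2.const_mul 2)).add (integrable_const _))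
            fun ω => potential_cons_le hk hF _ _ j
      _ = ∫ ω, potential F (hist F ω t) j ∂tapeMeasure +
            2 * ∫ ω, drift F (hist F ω t) j (playAction F (hist F ω t) ω) ∂tapeMeasure + k := by
          have i3 : Integrable (fun ω => potential F (hist F ω t) j +
              2 * drift F (hist F ω t) j (playAction F (hist F ω t) ω)) tapeMeasure :=
            i1.add (i2.const_mul 2)
          rw [integral_add i3 (integrable_const _), integral_add i1 (i2.const_mul 2),
            integral_const_mul]
          simp
      _ ≤ k * (t + 1 : ℕ) := by
          have := integral_drift_nonpos hk hF t j
          push_cast; linarith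

lemma integral_sqrt_potential_le (hk : 1 ≤ k) (hF : ∀ h, IsReward (F h)) (t : ℕ) (j : Fin n) :
    ∫ ω, Real.sqrt (potential F (hist F ω t) j) ∂tapeMeasure ≤ k * Real.sqrt t := by
  rcases Nat.eq_zero_or_pos t with rfl | ht
  · simp [hist, potential, regretVec]
  · have hk' : (1 : ℝ) ≤ k := by exact_mod_cast hk
    have ht' : (0 : ℝ) < t := by exact_mod_cast ht
    set r := (k : ℝ) * Real.sqrt t with hr
    have hr0 : 0 < r := mul_pos (by linarith) (Real.sqrt_pos.2 ht')
    have hr2 : (k : ℝ) * t ≤ r ^ 2 := by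
      rw [hr, mul_pow, Real.sq_sqrt ht'.le]
      exact mul_le_mul_of_nonneg_right (by nlinarith) ht'.le
    -- The tangent line of the square root at `r ^ 2` replaces Jensen's inequality; `r > 0` is why
    -- `t = 0` is treated apart.
    have hp : ∀ ω, Real.sqrt (potential F (hist F ω t) j) ≤
        (2 * r)⁻¹ * potential F (hist F ω t) j + r / 2 := fun ω => by
      have h := Real.sq_sqrt (potential_nonneg (F := F) (hist F ω t) j)
      rw [inv_mul_eq_div, div_add' _ _ _ (by positivity), le_div_iff₀ (by positivity)]
      nlinarith [sq_nonneg (Real.sqrt (potential F (hist F ω t) j) - r)]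
    have i1 := integrable_hist (F := F) (fun h => potential F h j) t
    calc _ ≤ ∫ ω, ((2 * r)⁻¹ * potential F (hist F ω t) j + r / 2) ∂tapeMeasure :=
          integral_mono (integrable_hist (fun h => Real.sqrt (potential F h j)) t)
            ((i1.const_mul _).add (integrable_const _)) hp
      _ = (2 * r)⁻¹ * ∫ ω, potential F (hist F ω t) j ∂tapeMeasure + r / 2 := by
          rw [integral_add (i1.const_mul _) (integrable_const _), integral_const_mul]
          simp
      _ ≤ (2 * r)⁻¹ * r ^ 2 + r / 2 := by
          gcongr
          exact (integral_potential_le hk hF t j).trans hr2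
      _ = r := by field_simp; ring

/-- The regret of a history. -/
def histRegret (F : Adversary n k) (h : List (Action n k)) : ℝ :=
  (k : ℝ) / (2 * k - 1) * Finset.univ.sup' Finset.univ_nonempty (fun o => cumReward F o h) -
    cumGain F h

lemma integral_histRegret_le (hk : 1 ≤ k) (hF : ∀ h, IsReward (F h)) (t : ℕ) :
    ∫ ω, histRegret F (hist F ω t) ∂tapeMeasure ≤ k * n * Real.sqrt t := by
  calc ∫ ω, histRegret F (hist F ω t) ∂tapeMeasure
      ≤ ∫ ω, ∑ j : Fin n, Real.sqrt (potential F (hist F ω t) j) ∂tapeMeasure := by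
        refine integral_mono (integrable_hist _ t)
          (integrable_hist (fun h => ∑ j : Fin n, Real.sqrt (potential F h j)) t) fun ω => ?_
        obtain ⟨o, _, ho⟩ := Finset.exists_mem_eq_sup' Finset.univ_nonempty
          (fun o => cumReward F o (hist F ω t))
        simp only [histRegret, ho]
        exact regret_le_sum_sqrt hk hF o _
    _ = ∑ j : Fin n, ∫ ω, Real.sqrt (potential F (hist F ω t) j) ∂tapeMeasure :=
        integral_finsetSum _ fun j _ => integrable_hist (fun h => Real.sqrt (potential F h j)) t
    _ ≤ ∑ _j : Fin n, k * Real.sqrt t :=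
        Finset.sum_le_sum fun j _ => integral_sqrt_potential_le hk hF t j
    _ = k * n * Real.sqrt t := by simp; ring

end Expectation

/-! ### The running time of programs with bounded loops -/

section Machine

/-- The expression whose value is `n`. -/
def sizeExpr : NatExpr := .read (.const 0) (.const 0)

/-- The expression whose value is `k`. -/
def colorsExpr : NatExpr := .read (.const 0) (.const 1)

/-- Programs that do not change their input and whose loops are executed at most `n + k` times. -/
def Cmd.Tame : Cmd → Prop
  | .setNat r _ _ => ∃ m, r = .const (m + 1)
  | .seq c d => c.Tame ∧ d.Tame
  | .ifNat _ _ c d => c.Tame ∧ d.Tame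
  | .ifReal _ _ c d => c.Tame ∧ d.Tame
  | .loop e c => (e = sizeExpr ∨ e = colorsExpr ∨ e = .sub colorsExpr (.const 1)) ∧ c.Tame
  | _ => True

open MvPolynomial in
/-- A bound for the number of steps of a tame program, in terms of the input. -/
def Cmd.timeBound : Cmd → MvPolynomial (Fin 3) ℕ
  | .skip => C 1
  | .setNat r c e => C (r.cost + c.cost + e.cost + 1)
  | .setReal r c e => C (r.cost + c.cost + e.cost + 1)
  | .draw r c => C (r.cost + c.cost + 1)
  | .query r c v => C (r.cost + c.cost + v.cost + 1)
  | .seq c d => c.timeBound + d.timeBound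
  | .ifNat e e' c d => C (e.cost + e'.cost + 1) + (c.timeBound + d.timeBound)
  | .ifReal e e' c d => C (e.cost + e'.cost + 1) + (c.timeBound + d.timeBound)
  | .loop e c => C (e.cost + 1) + (X 0 + X 1) * (C 1 + c.timeBound)

variable (orc : (ℕ → ℕ) → ℝ) (ω : Tape)

lemma exec_loop_invariant {e : NatExpr} {c : Cmd} {s : State} (I : ℕ → State → Prop)
    (h0 : I 0 (s.tick (e.cost + 1)))
    (hstep : ∀ m < e.val s, ∀ s', I m s' → I (m + 1) (c.exec orc ω (s'.tick 1))) :
    I (e.val s) ((Cmd.loop e c).exec orc ω s) := by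
  have : ∀ m ≤ e.val s,
      I m ((fun s' => Cmd.exec orc ω c (s'.tick 1))^[m] (s.tick (e.cost + 1))) := fun m => by
    induction m with
    | zero => exact fun _ => h0
    | succ m ih =>
      intro hm
      rw [Function.iterate_succ_apply']
      exact hstep m hm _ (ih (by omega))
  exact this _ le_rfl

/-- The two claims need a joint induction: a loop's length is read from row `0`, so the time bound
relies on that row being intact. -/
lemma Cmd.Tame.exec_spec {c : Cmd} (hc : c.Tame) (n k T : ℕ) (s : State) (hn : s.nat 0 0 = n)
    (hk : s.nat 0 1 = k) :
    (c.exec orc ω s).nat 0 = s.nat 0 ∧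
      (c.exec orc ω s).time ≤ s.time + MvPolynomial.eval ![n, k, T] c.timeBound := by
  induction c generalizing s with
  | skip => simp [Cmd.exec, Cmd.timeBound, State.tick]
  | setNat r c e =>
    obtain ⟨m, rfl⟩ := hc
    simp [Cmd.exec, Cmd.timeBound, State.tick, State.writeNat, NatExpr.val, Function.update]
  | setReal r c e => simp [Cmd.exec, Cmd.timeBound, State.tick, State.writeReal]
  | draw r c => simp [Cmd.exec, Cmd.timeBound, State.tick, State.writeReal]
  | query r c v => simp [Cmd.exec, Cmd.timeBound, State.tick, State.writeReal]
  | seq c d ihc ihd =>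
    obtain ⟨h1, h2⟩ := ihc hc.1 s hn hk
    obtain ⟨h3, h4⟩ := ihd hc.2 (c.exec orc ω s) (by rw [h1, hn]) (by rw [h1, hk])
    refine ⟨h3.trans h1, ?_⟩
    simp only [Cmd.exec, Cmd.timeBound, map_add]
    omega
  | ifNat e e' c d ihc ihd =>
    obtain ⟨h1, h2⟩ := ihc hc.1 (s.tick (e.cost + e'.cost + 1)) hn hk
    obtain ⟨h3, h4⟩ := ihd hc.2 (s.tick (e.cost + e'.cost + 1)) hn hk
    simp only [Cmd.exec, Cmd.timeBound, map_add, MvPolynomial.eval_C]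
    simp only [State.tick] at h1 h2 h3 h4 ⊢
    split_ifs
    · exact ⟨h1, by omega⟩
    · exact ⟨h3, by omega⟩
  | ifReal e e' c d ihc ihd =>
    obtain ⟨h1, h2⟩ := ihc hc.1 (s.tick (e.cost + e'.cost + 1)) hn hk
    obtain ⟨h3, h4⟩ := ihd hc.2 (s.tick (e.cost + e'.cost + 1)) hn hk
    simp only [Cmd.exec, Cmd.timeBound, map_add, MvPolynomial.eval_C]
    simp only [State.tick] at h1 h2 h3 h4 ⊢
    split_ifs
    · exact ⟨h1, by omega⟩
    · exact ⟨h3, by omega⟩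
  | loop e c ih =>
    have he : e.val s ≤ n + k := by
      rcases hc.1 with rfl | rfl | rfl <;>
        simp only [sizeExpr, colorsExpr, NatExpr.val, hn, hk] <;> omega
    have := exec_loop_invariant orc ω (e := e) (c := c) (s := s)
      (fun m s' => s'.nat 0 = s.nat 0 ∧ s'.time ≤ s.time + (e.cost + 1) +
        m * (1 + MvPolynomial.eval ![n, k, T] c.timeBound))
      ⟨rfl, by simp [State.tick]⟩ fun m _ s' hs' => by
        obtain ⟨h1, h2⟩ := ih hc.2 (s'.tick 1) (by rw [← hn, ← hs'.1]; rfl)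
          (by rw [← hk, ← hs'.1]; rfl)
        refine ⟨h1.trans hs'.1, ?_⟩
        have := hs'.2
        have e : (s'.tick 1).time = s'.time + 1 := rfl
        rw [Nat.succ_mul]; omega
    refine ⟨this.1, this.2.trans ?_⟩
    have hm := Nat.mul_le_mul_right (1 + MvPolynomial.eval ![n, k, T] c.timeBound) he
    simp only [Cmd.timeBound, map_add, map_mul, MvPolynomial.eval_C, MvPolynomial.eval_X,
      Matrix.cons_val_zero, Matrix.cons_val_one]
    omega

end Machine

/-! ### The algorithm

Row `1` of the natural-number memory holds the action, row `2` holds the loop counters and row `3`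
the vector that is passed to the oracle. Row `0` of the real memory is for temporary values; the
regret against colour `i` at coordinate `j` is held in the cell `(j + 1, i)`. -/

section Algorithm

def coordExpr : NatExpr := .read (.const 2) (.const 0)

def indexExpr : NatExpr := .read (.const 2) (.const 1)

def regretExpr : RealExpr :=
  .read (.add coordExpr (.const 1)) (.add indexExpr (.const 1))

def slackExpr : RealExpr :=
  .sub (.ofNat (.const 1)) (.div (.ofNat (.const 1)) (.ofNat colorsExpr))

def tempExpr (c : ℕ) : RealExpr := .read (.const 0) (.const c)

def setTemp (c : ℕ) (e : RealExpr) : Cmd := .setReal (.const 0) (.const c) e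

def setIndex (e : NatExpr) : Cmd := .setNat (.const 2) (.const 1) e

def setCoord (e : NatExpr) : Cmd := .setNat (.const 2) (.const 0) e

def totalStep : Cmd :=
  .seq (.ifReal (.ofNat (.const 0)) regretExpr (setTemp 1 (.add (tempExpr 1) regretExpr)) .skip)
    (setIndex (.add indexExpr (.const 1)))

def pickStep : Cmd :=
  .seq (.ifReal (.ofNat (.const 0)) regretExpr
      (setTemp 2 (.add (tempExpr 2)
        (.div regretExpr (.add regretExpr (.mul slackExpr (tempExpr 1)))))) .skip) <|
  .seq (.ifReal (tempExpr 2) (tempExpr 0)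
      (.setNat (.const 1) coordExpr (.add (.read (.const 1) coordExpr) (.const 1))) .skip) <|
  setIndex (.add indexExpr (.const 1))

def sampleInit : Cmd :=
  .seq (.draw (.const 0) (.const 0)) <|
  .seq (setTemp 1 (.ofNat (.const 0))) (setIndex (.const 0))

def pickInit : Cmd :=
  .seq (setTemp 2 (.ofNat (.const 0))) <|
  .seq (setIndex (.const 0)) (.setNat (.const 1) coordExpr (.const 1))

def playEnd : Cmd :=
  .seq (.setNat (.const 3) coordExpr (.const 0)) (setCoord (.add coordExpr (.const 1)))

def playStep : Cmd :=
  .seq sampleInit <| .seq (.loop colorsExpr totalStep) <| .seq pickInit <|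
  .seq (.loop (.sub colorsExpr (.const 1)) pickStep) playEnd

def playCmd : Cmd := .seq (setCoord (.const 0)) (.loop sizeExpr playStep)

def compareStep : Cmd :=
  .seq (.setNat (.const 3) coordExpr (.add indexExpr (.const 1))) <|
  .seq (.query (.const 0) (.const 5) (.const 3)) <|
  .seq (.setReal (.add coordExpr (.const 1)) (.add indexExpr (.const 1))
      (.add regretExpr (.sub (.sub (tempExpr 5) (tempExpr 3))
        (.mul slackExpr (.sub (tempExpr 4) (tempExpr 3)))))) <|
  setIndex (.add indexExpr (.const 1))

def learnInit : Cmd :=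
  .seq (.query (.const 0) (.const 3) (.const 3)) <|
  .seq (.setNat (.const 3) coordExpr (.read (.const 1) coordExpr)) <|
  .seq (.query (.const 0) (.const 4) (.const 3)) (setIndex (.const 0))

def learnEnd : Cmd :=
  .seq (.setNat (.const 3) coordExpr (.read (.const 1) coordExpr)) <|
  .seq (.setReal (.add coordExpr (.const 1)) (.read (.const 1) coordExpr)
      (.sub (.read (.add coordExpr (.const 1)) (.read (.const 1) coordExpr))
        (.sub (tempExpr 4) (tempExpr 3)))) <|
  setCoord (.add coordExpr (.const 1))

def learnStep : Cmd := .seq learnInit <| .seq (.loop colorsExpr compareStep) learnEnd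

def learnCmd : Cmd := .seq (setCoord (.const 0)) (.loop sizeExpr learnStep)

/-- Blackwell's strategy for every coordinate. -/
def blackwell : OnlineAlgorithm := ⟨playCmd, learnCmd⟩

lemma tame_playCmd : playCmd.Tame := by
  simp [playCmd, playStep, sampleInit, totalStep, pickInit, pickStep, playEnd, setTemp, setIndex,
    setCoord, Cmd.Tame]

lemma tame_learnCmd : learnCmd.Tame := by
  simp [learnCmd, learnStep, learnInit, compareStep, learnEnd, setIndex, setCoord, Cmd.Tame]

end Algorithm

/-! ### Correctness of the two programs -/

section Correctness

/-- The contents of the memory, except for temporary values. -/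
structure Holds (s : State) (N x v : ℕ → ℕ) (j d : ℕ) (R : ℕ → ℕ → ℝ) : Prop where
  input : s.nat 0 = N
  action : s.nat 1 = x
  coord : s.nat 2 0 = j
  vec : s.nat 3 = v
  regret : ∀ r, s.real (r + 1) = R r
  draws : s.draws = d

variable {orc : (ℕ → ℕ) → ℝ} {ω : Tape} {s : State} {N x v : ℕ → ℕ} {j d : ℕ}
  {R : ℕ → ℕ → ℝ}

lemma Holds.tick (h : Holds s N x v j d R) (m : ℕ) : Holds (s.tick m) N x v j d R :=
  ⟨h.1, h.2, h.3, h.4, h.5, h.6⟩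

attribute [local simp] setTemp setIndex setCoord tempExpr regretExpr coordExpr indexExpr sizeExpr
  colorsExpr slackExpr Cmd.exec NatExpr.val RealExpr.val State.tick State.writeNat State.writeReal
  Function.update_apply

lemma sampleInit_spec (h : Holds s N x v j d R) :
    Holds (sampleInit.exec orc ω s) N x v j (d + 1) R ∧ (sampleInit.exec orc ω s).nat 2 1 = 0 ∧
      (sampleInit.exec orc ω s).real 0 0 = ω d ∧ (sampleInit.exec orc ω s).real 0 1 = 0 := by
  obtain ⟨h1, h2, h3, h4, h5, h6⟩ := h
  refine ⟨⟨?_, ?_, ?_, ?_, ?_, ?_⟩, ?_, ?_, ?_⟩ <;> simp [sampleInit, *]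

lemma totalStep_spec (h : Holds s N x v j d R) {i : ℕ} (hi : s.nat 2 1 = i) :
    Holds (totalStep.exec orc ω s) N x v j d R ∧ (totalStep.exec orc ω s).nat 2 1 = i + 1 ∧
      (totalStep.exec orc ω s).real 0 0 = s.real 0 0 ∧
      (totalStep.exec orc ω s).real 0 1 = s.real 0 1 + max (R j (i + 1)) 0 := by
  obtain ⟨h1, h2, h3, h4, h5, h6⟩ := h
  by_cases h0 : 0 ≤ R j (i + 1)
  · refine ⟨⟨?_, ?_, ?_, ?_, ?_, ?_⟩, ?_, ?_, ?_⟩ <;> simp [totalStep, *]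
  · have h0' := max_eq_right (not_le.1 h0).le
    refine ⟨⟨?_, ?_, ?_, ?_, ?_, ?_⟩, ?_, ?_, ?_⟩ <;> simp [totalStep, *]

lemma totalLoop_spec (h : Holds s N x v j d R) (hi : s.nat 2 1 = 0) (h1 : s.real 0 1 = 0) :
    Holds ((Cmd.loop colorsExpr totalStep).exec orc ω s) N x v j d R ∧
      ((Cmd.loop colorsExpr totalStep).exec orc ω s).real 0 0 = s.real 0 0 ∧
      ((Cmd.loop colorsExpr totalStep).exec orc ω s).real 0 1 = total (N 1) (R j) := by
  have hk : colorsExpr.val s = N 1 := by simp [h.input]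
  have := exec_loop_invariant orc ω (e := colorsExpr) (c := totalStep) (s := s)
    (fun m s' => Holds s' N x v j d R ∧ s'.nat 2 1 = m ∧ s'.real 0 0 = s.real 0 0 ∧
      s'.real 0 1 = ∑ i ∈ Finset.range m, max (R j (i + 1)) 0)
    ⟨h.tick _, hi, rfl, by simpa using h1⟩ fun m _ s' ⟨a1, a2, a3, a4⟩ => by
      obtain ⟨b1, b2, b3, b4⟩ := totalStep_spec (orc := orc) (ω := ω) (a1.tick 1) (i := m) a2
      exact ⟨b1, b2, b3.trans a3, by rw [b4, Finset.sum_range_succ, ← a4]; rfl⟩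
  rw [hk] at this
  exact ⟨this.1, this.2.2⟩

lemma pickInit_spec (h : Holds s N x v j d R) :
    Holds (pickInit.exec orc ω s) N (Function.update x j 1) v j d R ∧
      (pickInit.exec orc ω s).nat 2 1 = 0 ∧
      (pickInit.exec orc ω s).real 0 0 = s.real 0 0 ∧
      (pickInit.exec orc ω s).real 0 1 = s.real 0 1 ∧
      (pickInit.exec orc ω s).real 0 2 = 0 := by
  obtain ⟨h1, h2, h3, h4, h5, h6⟩ := h
  refine ⟨⟨?_, ?_, ?_, ?_, ?_, ?_⟩, ?_, ?_, ?_, ?_⟩ <;> simp [pickInit, *]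

lemma pickStep_spec (h : Holds s N x v j d R) {i : ℕ} (hi : s.nat 2 1 = i)
    (hW : s.real 0 1 = total (N 1) (R j)) :
    Holds (pickStep.exec orc ω s) N (Function.update x j (x j +
        if s.real 0 2 + prob (N 1) (R j) i ≤ s.real 0 0 then 1 else 0)) v j d R ∧
      (pickStep.exec orc ω s).nat 2 1 = i + 1 ∧
      (pickStep.exec orc ω s).real 0 0 = s.real 0 0 ∧
      (pickStep.exec orc ω s).real 0 1 = s.real 0 1 ∧
      (pickStep.exec orc ω s).real 0 2 = s.real 0 2 + prob (N 1) (R j) i := by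
  obtain ⟨h1, h2, h3, h4, h5, h6⟩ := h
  by_cases h0 : 0 ≤ R j (i + 1)
  · have hp : prob (N 1) (R j) i =
        R j (i + 1) / (R j (i + 1) + (1 - (N 1 : ℝ)⁻¹) * total (N 1) (R j)) := by
      rw [prob, max_eq_left h0, slack, one_div]
    rw [hp]
    by_cases hu : s.real 0 2 +
        R j (i + 1) / (R j (i + 1) + (1 - (N 1 : ℝ)⁻¹) * total (N 1) (R j)) ≤ s.real 0 0
    · refine ⟨⟨?_, ?_, ?_, ?_, ?_, ?_⟩, ?_, ?_, ?_, ?_⟩ <;> simp [pickStep, *]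
    · refine ⟨⟨?_, ?_, ?_, ?_, ?_, ?_⟩, ?_, ?_, ?_, ?_⟩ <;> simp [pickStep, *]
  · have hp : prob (N 1) (R j) i = 0 := by
      rw [prob, max_eq_right (not_le.1 h0).le, zero_div]
    rw [hp, add_zero]
    by_cases hu : s.real 0 2 ≤ s.real 0 0
    · refine ⟨⟨?_, ?_, ?_, ?_, ?_, ?_⟩, ?_, ?_, ?_, ?_⟩ <;> simp [pickStep, *]
    · refine ⟨⟨?_, ?_, ?_, ?_, ?_, ?_⟩, ?_, ?_, ?_, ?_⟩ <;> simp [pickStep, *]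

lemma pickLoop_spec (h : Holds s N x v j d R) (hi : s.nat 2 1 = 0) (hx : x j = 1)
    (hW : s.real 0 1 = total (N 1) (R j)) (hC : s.real 0 2 = 0) :
    Holds ((Cmd.loop (.sub colorsExpr (.const 1)) pickStep).exec orc ω s) N
      (Function.update x j (pick (N 1) (R j) (s.real 0 0))) v j d R := by
  have hk : (NatExpr.sub colorsExpr (.const 1)).val s = N 1 - 1 := by simp [h.input]
  have := exec_loop_invariant orc ω (e := .sub colorsExpr (.const 1)) (c := pickStep) (s := s)
    -- Pass `m` adds `prob m` before comparing, so its threshold is `cumProb (m + 1)`, as in `pick`.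
    (fun m s' => Holds s' N (Function.update x j (1 + ∑ l ∈ Finset.range m,
        if cumProb (N 1) (R j) (l + 1) ≤ s.real 0 0 then 1 else 0)) v j d R ∧
      s'.nat 2 1 = m ∧ s'.real 0 0 = s.real 0 0 ∧ s'.real 0 1 = total (N 1) (R j) ∧
      s'.real 0 2 = cumProb (N 1) (R j) m)
    ⟨by simpa [← hx] using h.tick _, hi, rfl, hW, by simpa [cumProb] using hC⟩
    fun m _ s' ⟨a1, a2, a3, a4, a5⟩ => by
      obtain ⟨b1, b2, b3, b4, b5⟩ := pickStep_spec (orc := orc) (ω := ω) (a1.tick 1) (i := m) a2 a4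
      have e : (s'.tick 1).real 0 2 + prob (N 1) (R j) m = cumProb (N 1) (R j) (m + 1) := by
        rw [cumProb, Finset.sum_range_succ, ← cumProb, ← a5]; rfl
      rw [e] at b1 b5
      rw [show (s'.tick 1).real 0 0 = s.real 0 0 from a3, Function.update_idem,
        Function.update_self, add_assoc, ← Finset.sum_range_succ] at b1
      exact ⟨b1, b2, b3.trans a3, b4.trans a4, b5⟩
  rw [hk] at this
  exact this.1

lemma playEnd_spec (h : Holds s N x v j d R) :
    Holds (playEnd.exec orc ω s) N x (Function.update v j 0) (j + 1) d R := by
  obtain ⟨h1, h2, h3, h4, h5, h6⟩ := h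
  refine ⟨?_, ?_, ?_, ?_, ?_, ?_⟩ <;> simp [playEnd, *]

lemma playStep_spec (h : Holds s N x v j d R) :
    Holds (playStep.exec orc ω s) N (Function.update x j (pick (N 1) (R j) (ω d)))
      (Function.update v j 0) (j + 1) (d + 1) R := by
  obtain ⟨a1, a2, a3, a4⟩ := sampleInit_spec (orc := orc) (ω := ω) h
  obtain ⟨b1, b2, b3⟩ := totalLoop_spec (orc := orc) (ω := ω) a1 a2 a4
  obtain ⟨c1, c2, c3, c4, c5⟩ := pickInit_spec (orc := orc) (ω := ω) b1
  have e := playEnd_spec (orc := orc) (ω := ω)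
    (pickLoop_spec (orc := orc) (ω := ω) c1 c2 (by simp) (c4.trans b3) c5)
  rw [c3, b2, a3, Function.update_idem] at e
  exact e

lemma setCoord_zero_spec (h : Holds s N x v j d R) :
    Holds ((setCoord (.const 0)).exec orc ω s) N x v 0 d R := by
  obtain ⟨h1, h2, h3, h4, h5, h6⟩ := h
  refine ⟨?_, ?_, ?_, ?_, ?_, ?_⟩ <;> simp [*]

/-- The zeros in row `3` make the learning phase start its queries from the zero vector. -/
lemma playCmd_spec (h : Holds s N x v j d R) :
    ∃ x' v', Holds (playCmd.exec orc ω s) N x' v' (N 0) (d + N 0) R ∧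
      ∀ l < N 0, x' l = pick (N 1) (R l) (ω (d + l)) ∧ v' l = 0 := by
  have h' := setCoord_zero_spec (orc := orc) (ω := ω) h
  have hn : sizeExpr.val ((setCoord (.const 0)).exec orc ω s) = N 0 := by
    change State.nat _ 0 0 = N 0
    rw [h'.input]
  have := exec_loop_invariant orc ω (e := sizeExpr) (c := playStep)
    (s := (setCoord (.const 0)).exec orc ω s)
    (fun m s' => ∃ x' v', Holds s' N x' v' m (d + m) R ∧
      ∀ l < m, x' l = pick (N 1) (R l) (ω (d + l)) ∧ v' l = 0)
    ⟨x, v, h'.tick _, fun l hl => absurd hl (Nat.not_lt_zero l)⟩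
    fun m _ s' ⟨x', v', a1, a2⟩ => by
      refine ⟨_, _, playStep_spec (a1.tick 1), fun l hl => ?_⟩
      by_cases e : l = m
      · subst e; simp
      · rw [Function.update_of_ne e, Function.update_of_ne e]; exact a2 l (by omega)
  rw [hn] at this
  exact this

lemma learnInit_spec (h : Holds s N x v j d R) :
    Holds (learnInit.exec orc ω s) N x (Function.update v j (x j)) j d R ∧
      (learnInit.exec orc ω s).nat 2 1 = 0 ∧
      (learnInit.exec orc ω s).real 0 3 = orc v ∧
      (learnInit.exec orc ω s).real 0 4 = orc (Function.update v j (x j)) := by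
  obtain ⟨h1, h2, h3, h4, h5, h6⟩ := h
  refine ⟨⟨?_, ?_, ?_, ?_, ?_, ?_⟩, ?_, ?_, ?_⟩ <;> simp [learnInit, *]

lemma compareStep_spec (h : Holds s N x v j d R) {i : ℕ} (hi : s.nat 2 1 = i) :
    Holds (compareStep.exec orc ω s) N x (Function.update v j (i + 1)) j d
        (Function.update R j (Function.update (R j) (i + 1) (R j (i + 1) +
          ((orc (Function.update v j (i + 1)) - s.real 0 3) -
            slack (N 1) * (s.real 0 4 - s.real 0 3))))) ∧
      (compareStep.exec orc ω s).nat 2 1 = i + 1 ∧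
      (compareStep.exec orc ω s).real 0 3 = s.real 0 3 ∧
      (compareStep.exec orc ω s).real 0 4 = s.real 0 4 := by
  obtain ⟨h1, h2, h3, h4, h5, h6⟩ := h
  refine ⟨⟨?_, ?_, ?_, ?_, ?_, ?_⟩, ?_, ?_, ?_⟩ <;> simp [compareStep, slack, *]

/-- The value `a` left at position `j` is irrelevant, since `learnEnd` overwrites it with the played
colour. -/
lemma compareLoop_spec (h : Holds s N x v j d R) (hi : s.nat 2 1 = 0) :
    ∃ a, Holds ((Cmd.loop colorsExpr compareStep).exec orc ω s) N x (Function.update v j a) j d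
        (Function.update R j fun c => R j c + if 1 ≤ c ∧ c ≤ N 1 then
          (orc (Function.update v j c) - s.real 0 3) -
            slack (N 1) * (s.real 0 4 - s.real 0 3) else 0) ∧
      ((Cmd.loop colorsExpr compareStep).exec orc ω s).real 0 3 = s.real 0 3 ∧
      ((Cmd.loop colorsExpr compareStep).exec orc ω s).real 0 4 = s.real 0 4 := by
  have hk : colorsExpr.val s = N 1 := by simp [h.input]
  have := exec_loop_invariant orc ω (e := colorsExpr) (c := compareStep) (s := s)
    (fun m s' => s'.nat 2 1 = m ∧ ∃ a, Holds s' N x (Function.update v j a) j d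
        (Function.update R j fun c => R j c + if 1 ≤ c ∧ c ≤ m then
          (orc (Function.update v j c) - s.real 0 3) -
            slack (N 1) * (s.real 0 4 - s.real 0 3) else 0) ∧
      s'.real 0 3 = s.real 0 3 ∧ s'.real 0 4 = s.real 0 4)
    ⟨hi, v j, by
      have : ∀ c, ¬ (1 ≤ c ∧ c ≤ 0) := fun c => by omega
      simpa only [if_neg (this _), add_zero, Function.update_eq_self] using h.tick _, rfl, rfl⟩
    fun m _ s' ⟨a1, a, a2, a3, a4⟩ => by
      obtain ⟨b1, b2, b3, b4⟩ := compareStep_spec (orc := orc) (ω := ω) (a2.tick 1) (i := m) a1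
      refine ⟨b2, m + 1, ?_, b3.trans a3, b4.trans a4⟩
      rw [show (s'.tick 1).real 0 3 = s.real 0 3 from a3,
        show (s'.tick 1).real 0 4 = s.real 0 4 from a4, Function.update_idem,
        Function.update_idem, Function.update_self] at b1
      convert b1 using 2
      funext c
      by_cases hc : c = m + 1
      · subst hc; simp
      · have : (1 ≤ c ∧ c ≤ m + 1) ↔ (1 ≤ c ∧ c ≤ m) := by omega
        simp only [Function.update_of_ne hc, this]
  rw [hk] at this
  exact this.2

lemma learnEnd_spec (h : Holds s N x v j d R) :
    Holds (learnEnd.exec orc ω s) N x (Function.update v j (x j)) (j + 1) d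
      (Function.update R j (Function.update (R j) (x j)
        (R j (x j) - (s.real 0 4 - s.real 0 3)))) := by
  obtain ⟨h1, h2, h3, h4, h5, h6⟩ := h
  refine ⟨?_, ?_, ?_, ?_, ?_, ?_⟩ <;> simp [learnEnd, *]

lemma learnStep_spec (h : Holds s N x v j d R) :
    ∃ R', Holds (learnStep.exec orc ω s) N x (Function.update v j (x j)) (j + 1) d R' ∧
      (∀ r ≠ j, R' r = R r) ∧
      ∀ c, 1 ≤ c → c ≤ N 1 → R' j c = R j c +
        ((orc (Function.update v j c) - orc v) -
          slack (N 1) * (orc (Function.update v j (x j)) - orc v) -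
          if c = x j then orc (Function.update v j (x j)) - orc v else 0) := by
  obtain ⟨a1, a2, a3, a4⟩ := learnInit_spec (orc := orc) (ω := ω) h
  obtain ⟨a, b1, b2, b3⟩ := compareLoop_spec (orc := orc) (ω := ω) a1 a2
  have e := learnEnd_spec (orc := orc) (ω := ω) b1
  rw [b2, b3, a3, a4] at e
  simp only [Function.update_idem] at e
  refine ⟨_, e, fun r hr => Function.update_of_ne hr _ _, fun c h1 h2 => ?_⟩
  by_cases hc : c = x j
  · subst hc; simp [h1, h2]; ring
  · simp [hc, h1, h2]

end Correctness

/-! ### The machine simulates the idealized strategy -/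

section Rounds

variable {n k : ℕ}

lemma decode_update (v : ℕ → ℕ) (j : Fin n) (c : ℕ) :
    decode n k (Function.update v j c) = Function.update (decode n k v) j (Fin.ofNat (k + 1) c) := by
  funext l
  by_cases hl : l = j
  · subst hl; simp [decode]
  · have : (l : ℕ) ≠ j := fun e => hl (Fin.ext e)
    simp only [decode, Function.update_of_ne this, Function.update_of_ne hl]

lemma decode_eq_splice {x v : ℕ → ℕ} {m : ℕ} (h : ∀ l < n, v l = if l < m then x l else 0) :
    decode n k v = splice (decode n k x) 0 m := by
  funext l
  simp only [decode, splice, h l l.2]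
  split_ifs
  · rfl
  · rfl

/-- Needed because the memory is known to agree with `regretVec` only at the colours `1, …, k`. -/
lemma pick_congr {ρ ρ' : ℕ → ℝ} (h : ∀ c, 1 ≤ c → c ≤ k → ρ c = ρ' c) (u : ℝ) :
    pick k ρ u = pick k ρ' u := by
  have ht : total k ρ = total k ρ' := Finset.sum_congr rfl fun i hi => by
    rw [h (i + 1) (by omega) (Finset.mem_range.1 hi)]
  have hc : ∀ m < k, cumProb k ρ m = cumProb k ρ' m := fun m hm =>
    Finset.sum_congr rfl fun i hi => by
      have := Finset.mem_range.1 hi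
      rw [prob, prob, ht, h (i + 1) (by omega) (by omega)]
  unfold pick
  congr 1
  refine Finset.sum_congr rfl fun m hm => ?_
  have := Finset.mem_range.1 hm
  rw [hc (m + 1) (by omega)]

lemma learnCmd_spec {ω : Tape} {s : State} {N x v : ℕ → ℕ} {j d : ℕ} {R : ℕ → ℕ → ℝ}
    (f : Action n k → ℝ) (h : Holds s N x v j d R) (hn : N 0 = n) (hk : N 1 = k)
    (hx : ∀ l < n, x l ≤ k) (hv : ∀ l < n, v l = 0) :
    ∃ v' R', Holds (learnCmd.exec (fun v => f (decode n k v)) ω s) N x v' n d R' ∧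
      ∀ (l : Fin n) (c : ℕ), 1 ≤ c → c ≤ k →
        R' l c = R l c + increment f (decode n k x) l c := by
  have h' := setCoord_zero_spec (orc := fun v => f (decode n k v)) (ω := ω) h
  have hn' : sizeExpr.val ((setCoord (.const 0)).exec (fun v => f (decode n k v)) ω s) = n := by
    change State.nat _ 0 0 = n
    rw [h'.input, hn]
  have := exec_loop_invariant (fun v => f (decode n k v)) ω (e := sizeExpr) (c := learnStep)
    (s := (setCoord (.const 0)).exec (fun v => f (decode n k v)) ω s)
    -- Row `3` decodes to the prefix `splice x 0 m`, so differences of oracle answers are the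
    -- marginals in `increment`.
    (fun m s' => ∃ v' R', Holds s' N x v' m d R' ∧ (∀ l < n, v' l = if l < m then x l else 0) ∧
      ∀ (l : Fin n) (c : ℕ), 1 ≤ c → c ≤ k →
        R' l c = R l c + if (l : ℕ) < m then increment f (decode n k x) l c else 0)
    ⟨v, R, h'.tick _, by simpa using hv, by simp⟩
    fun m hm s' ⟨v', R', a1, a2, a3⟩ => by
      obtain ⟨R'', b1, b2, b3⟩ :=
        learnStep_spec (orc := fun v => f (decode n k v)) (ω := ω) (a1.tick 1)
      rw [hn'] at hm
      refine ⟨_, R'', b1, fun l hl => ?_, fun l c h1 h2 => ?_⟩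
      · by_cases e : l = m
        · subst e; simp
        · rw [Function.update_of_ne e, a2 l hl]
          have : l < m ↔ l < m + 1 := by omega
          simp only [this]
      · by_cases e : (l : ℕ) = m
        -- Since `x l ≤ k`, decoding does not reduce the entry, and the machine's colour agrees with
        -- the one tested in `increment`.
        · have hxl : ((decode n k x l : Fin (k + 1)) : ℕ) = x l :=
            Nat.mod_eq_of_lt (Nat.lt_succ_of_le (hx l l.2))
          subst e
          rw [b3 c h1 (hk ▸ h2), a3 l c h1 h2, if_neg (lt_irrefl _), if_pos (Nat.lt_succ_self _),
            decode_update, decode_update, decode_eq_splice a2, hk, increment, hxl, add_zero]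
          rfl
        · rw [b2 _ e, a3 l c h1 h2]
          have : (l : ℕ) < m ↔ (l : ℕ) < m + 1 := by omega
          simp only [this]
  rw [hn'] at this
  obtain ⟨v', R', a1, _, a3⟩ := this
  exact ⟨v', R', a1, fun l c h1 h2 => by rw [a3 l c h1 h2, if_pos l.2]⟩

variable (F : Adversary n k) (T : ℕ) (ω : Tape)

lemma afterRounds_succ (A : OnlineAlgorithm) (t : ℕ) :
    afterRounds A T F ω (t + 1) = round A F ω (afterRounds A T F ω t) :=
  Function.iterate_succ_apply' _ _ _

/-- The machine represents the history. -/
def Represents (q : State × List (Action n k)) : Prop :=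
  ∃ x v j R, Holds q.1 ((initState n k T).nat 0) x v j (q.2.length * n) R ∧
    ∀ (l : Fin n) (c : ℕ), 1 ≤ c → c ≤ k → R l c = regretVec F q.2 l c

variable {F T ω}

lemma Represents.play_spec (hk : 1 ≤ k) {q : State × List (Action n k)}
    (hq : Represents F T q) (orc : (ℕ → ℕ) → ℝ) :
    ∃ x v j R, Holds (playCmd.exec orc ω q.1) ((initState n k T).nat 0) x v j
        ((q.2.length + 1) * n) R ∧
      (∀ (l : Fin n) (c : ℕ), 1 ≤ c → c ≤ k → R l c = regretVec F q.2 l c) ∧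
      (∀ l < n, x l ≤ k ∧ v l = 0) ∧ decode n k x = playAction F q.2 ω := by
  obtain ⟨x, v, j, R, h, hR⟩ := hq
  have hN0 : (initState n k T).nat 0 0 = n := rfl
  have hN1 : (initState n k T).nat 0 1 = k := rfl
  obtain ⟨x', v', h1, h2⟩ := playCmd_spec (orc := orc) (ω := ω) h
  -- Exactly `n` draws per round, which matches the tape index in `playAction`.
  rw [hN0, ← Nat.succ_mul] at h1
  rw [hN0, hN1] at h2
  refine ⟨x', v', _, R, h1, hR, fun l hl => ⟨(h2 l hl).1 ▸ pick_le hk _, (h2 l hl).2⟩, ?_⟩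
  funext l
  rw [decode, (h2 l l.2).1, playAction, pick_congr (hR l)]

lemma Represents.round_spec (hk : 1 ≤ k) {q : State × List (Action n k)}
    (hq : Represents F T q) :
    Represents F T (round blackwell F ω q) ∧
      (round blackwell F ω q).2 = playAction F q.2 ω :: q.2 := by
  obtain ⟨x, v, j, R, h, hR, hxv, hdec⟩ := hq.play_spec (ω := ω) hk fun _ => 0
  obtain ⟨v', R', h', hR'⟩ := learnCmd_spec (ω := ω) (F q.2) h rfl rfl
    (fun l hl => (hxv l hl).1) fun l hl => (hxv l hl).2
  have e : (round blackwell F ω q).2 = playAction F q.2 ω :: q.2 := by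
    simp only [round, blackwell]
    rw [h.action, hdec]
  refine ⟨⟨x, v', n, R', ?_, fun l c h1 h2 => ?_⟩, e⟩
  · rw [e]; exact h'
  · rw [e, hR' l c h1 h2, hR l c h1 h2, hdec]; rfl

lemma afterRounds_spec (hk : 1 ≤ k) (t : ℕ) :
    Represents F T (afterRounds blackwell T F ω t) ∧
      (afterRounds blackwell T F ω t).2 = hist F ω t := by
  induction t with
  | zero =>
    refine ⟨⟨fun _ => 0, fun _ => 0, 0, fun _ _ => 0, ⟨rfl, ?_, rfl, ?_, fun _ => rfl, ?_⟩,
      fun _ _ _ _ => rfl⟩, rfl⟩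
    · funext c; simp [afterRounds, initState]
    · funext c; simp [afterRounds, initState]
    · simp [afterRounds, initState]
  | succ t ih =>
    obtain ⟨h1, h2⟩ := ih.1.round_spec (ω := ω) hk
    rw [afterRounds_succ]
    exact ⟨h1, by rw [h2, ih.2]; rfl⟩

lemma action_eq (hk : 1 ≤ k) (t : ℕ) :
    action blackwell T F ω t = playAction F (hist F ω t) ω := by
  obtain ⟨h1, h2⟩ := afterRounds_spec (F := F) (T := T) (ω := ω) hk t
  obtain ⟨x, v, j, R, h, _, _, hdec⟩ := h1.play_spec (ω := ω) hk fun _ => 0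
  rw [h2] at hdec
  rw [action, ← hdec]
  exact congrArg _ h.action

lemma regret_eq (hk : 1 ≤ k) :
    regret blackwell T F ω ((k : ℝ) / (2 * k - 1)) = histRegret F (hist F ω T) := by
  have hr : ∀ t, reward blackwell T F ω t = F (hist F ω t) := fun t => by
    rw [reward, (afterRounds_spec hk t).2]
  have h1 : ∀ (o : Action n k) (t : ℕ), ∑ i ∈ Finset.range t, reward blackwell T F ω i o =
      cumReward F o (hist F ω t) := fun o t => by
    induction t with
    | zero => rfl
    | succ t ih => rw [Finset.sum_range_succ, ih, hr]; rfl
  have h2 : ∀ t : ℕ, ∑ i ∈ Finset.range t, reward blackwell T F ω i (action blackwell T F ω i) =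
      cumGain F (hist F ω t) := fun t => by
    induction t with
    | zero => rfl
    | succ t ih => rw [Finset.sum_range_succ, ih, hr, action_eq hk]; rfl
  simp only [regret, histRegret, h1, h2]

lemma runningTime_le : runningTime blackwell T F ω ≤ MvPolynomial.eval ![n, k, T]
    (MvPolynomial.X 2 * (playCmd.timeBound + learnCmd.timeBound)) := by
  have : ∀ t, (afterRounds blackwell T F ω t).1.nat 0 = (initState n k T).nat 0 ∧
      (afterRounds blackwell T F ω t).1.time ≤
        t * MvPolynomial.eval ![n, k, T] (playCmd.timeBound + learnCmd.timeBound) := fun t => by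
    induction t with
    | zero => exact ⟨rfl, Nat.zero_le _⟩
    | succ t ih =>
      rw [afterRounds_succ]
      generalize afterRounds blackwell T F ω t = q at ih
      obtain ⟨h1, h2⟩ := tame_playCmd.exec_spec (fun _ => 0) ω n k T q.1
        (by rw [ih.1]; rfl) (by rw [ih.1]; rfl)
      obtain ⟨h3, h4⟩ := tame_learnCmd.exec_spec (fun v => F q.2 (decode n k v)) ω n k T
        (playCmd.exec (fun _ => 0) ω q.1) (by rw [h1, ih.1]; rfl) (by rw [h1, ih.1]; rfl)
      refine ⟨h3.trans (h1.trans ih.1), h4.trans ?_⟩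
      have := ih.2
      rw [map_add] at this ⊢
      rw [Nat.succ_mul]; omega
  have := (this T).2
  simpa [runningTime] using this

end Rounds

end KSub

end

theorem mainTheorem2 :
    ∃ (A : KSub.OnlineAlgorithm) (P : MvPolynomial (Fin 3) ℕ) (C : ℝ),
      ∀ (n k T : ℕ), 1 ≤ k →
        ∀ F : KSub.Adversary n k, (∀ h, KSub.IsReward (F h)) →
          (∀ ω : KSub.Tape, KSub.runningTime A T F ω ≤ MvPolynomial.eval ![n, k, T] P) ∧
          MeasureTheory.Integrable
            (fun ω => KSub.regret A T F ω ((k : ℝ) / (2 * (k : ℝ) - 1))) KSub.tapeMeasure ∧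
          ∫ ω, KSub.regret A T F ω ((k : ℝ) / (2 * (k : ℝ) - 1)) ∂KSub.tapeMeasure
            ≤ C * ((k : ℝ) * (n : ℝ) * Real.sqrt (T : ℝ)) := by
  refine ⟨KSub.blackwell, _, 1, fun n k T hk F hF => ⟨fun ω => KSub.runningTime_le, ?_⟩⟩
  simp only [KSub.regret_eq hk, one_mul]
  exact ⟨KSub.integrable_hist _ T, KSub.integral_histRegret_le hk hF T⟩
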